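/- Let $G$ be a finite simple graph with node set $V$. For $A\subseteq V$ let $CN(A)$ be the set of nodes adjacent to all nodes of $A$ (so $CN(\emptyset)=V$), and write $A\uplus B=(A\times\{0\})\cup(B\times\{1\})$. Fix a strict linear order $\prec$ on the subsets of $V$ that refines the order by cardinality (for example, by cardinality and then lexicographically). Consider the following simplicial complexes. - The Lovász complex $L(G)$: its simplices are the chains of nonempty sets $A\subseteq V$ with $CN(A)\neq\emptyset$ and $CN(CN(A))=A$; its $\mathbb Z_2$-action is $CN$. - The box complex $B(G)$: its simplices are the sets $A\uplus B$ such that $CN(A)\ne\emptyset\ne CN(B)$ and every node of $A$ is adjacent to every node of $B$; its $\mathbb Z_2$-action interchanges the two shores, $A\uplus B\mapsto B\uplus A$. - The shore subdivision $\mathrm{ssd}\,B(G)$: the union, over the simplices $A\uplus B$ of $B(G)$, of the joins $\mathrm{sd}(A)*\mathrm{sd}(B)$ of the barycentric subdivisions of the simplices $A$ and $B$ on the two shores. Its vertices are of the form $A\uplus\emptyset$ and $\emptyset\uplus A$. - The doubled Lovász complex $DL(G)\subseteq\mathrm{ssd}\,B(G)$: the image of $\mathrm{ssd}\,B(G)$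 under the vertex map $A\uplus\emptyset\mapsto CN^2(A)\uplus\emptyset$, $\emptyset\uplus A\mapsto\emptyset\uplus CN^2(A)$. - The halved doubled Lovász complex $HDL(G)$: the image of $DL(G)$ under the vertex map $j$ sending $A\uplus\emptyset$ to $\emptyset\uplus CN(A)$ if $CN(A)\prec A$ and to itself otherwise, and sending $\emptyset\uplus A$ to $CN(A)\uplus\emptyset$ if $CN(A)\prec A$ and to itself otherwise. All these complexes are free $\mathbb Z_2$-complexes, with the interchange of the shores as the action on $\mathrm{ssd}\,B(G)$, $DL(G)$ and $HDL(G)$. The map sending $A\uplus\emptyset$ and $\emptyset\uplus A$ to the barycenters of the corresponding simplices of $B(G)$, extended affinely on simplices, is a $\mathbb Z_2$-equivariant homeomorphism $\|\mathrm{ssd}\,B(G)\|\to\|B(G)\|$, by which $\|HDL(G)\|$ is regarded as a subspace of $\|B(G)\|$. A $\mathbb Z_2$-invariant subspace $A$ of a $\mathbb Z_2$-space $X$ is a strong $\mathbb Z_2$-deformation retract of $X$ if there is a homotopy from $\mathrm{id}_X$ to a map with values in $A$ that fixes every point of $A$ at all times and is $\mathbb Z_2$-equivariant at all times. Then $HDL(G)$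 is $\mathbb Z_2$-isomorphic to $L(G)$, and $\|HDL(G)\|$ is a strong $\mathbb Z_2$-deformation retract of $\|B(G)\|$. Moreover, $\|DL(G)\|$ is a strong $\mathbb Z_2$-deformation retract of $\|\mathrm{ssd}\,B(G)\|$, and $\|HDL(G)\|$ is a strong $\mathbb Z_2$-deformation retract of $\|DL(G)\|$. -/

import Mathlib

/-! ### Geometric realizations of finite abstract simplicial complexes

Abstract simplicial complexes are Mathlib's `PreAbstractSimplicialComplex`: down-closed families of
nonempty finite sets (the empty simplex, which is invisible in the realization, is left out). -/

/-- The vertices of an abstract simplicial complex. -/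
def complexVertices {α : Type*} (K : PreAbstractSimplicialComplex α) : Set α :=
  {v | {v} ∈ K.faces}

/-- The geometric realization `‖K‖`, as a subspace of `ℝ ^ α`: the points of the standard simplex
whose support is a face of `K`. -/
def geomRealization {α : Type*} [Fintype α] (K : PreAbstractSimplicialComplex α) : Set (α → ℝ) :=
  {x | x ∈ stdSimplex ℝ α ∧ Finset.univ.filter (fun a => x a ≠ 0) ∈ K.faces}

/-- The affine extension `‖f‖` of a vertex map `f`: it sends the `a`-th basis vector to the
`f a`-th one. -/
def geomMap {α β : Type*} [Fintype α] [DecidableEq β] (f : α → β) (x : α → ℝ) : β → ℝ :=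
  fun b => ∑ a ∈ Finset.univ.filter (fun a => f a = b), x a

/-! ### `ℤ₂`-spaces -/

/-- `X` with the map `ν` is a `ℤ₂`-space: `ν` restricts to a self-inverse homeomorphism of `X`
without fixed points. -/
def IsZ2Space {E : Type*} [TopologicalSpace E] (ν : E → E) (X : Set E) : Prop :=
  Set.MapsTo ν X X ∧ ContinuousOn ν X ∧ (∀ x ∈ X, ν (ν x) = x) ∧ ∀ x ∈ X, ν x ≠ x

/-- `K` with the vertex map `ν` is a simplicial `ℤ₂`-space: `ν` is simplicial and `‖ν‖` is a free
`ℤ₂`-action on `‖K‖`. -/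
def IsSimplicialZ2Space {α : Type*} [Fintype α] [DecidableEq α]
    (ν : α → α) (K : PreAbstractSimplicialComplex α) : Prop :=
  (∀ σ ∈ K.faces, σ.image ν ∈ K.faces) ∧ IsZ2Space (geomMap ν) (geomRealization K)

/-- `(K, ν)` and `(L, μ)` are isomorphic simplicial `ℤ₂`-spaces: there is an equivariant map,
injective on vertices, under which the faces of `L` are exactly the images of the faces of `K`. -/
def IsZ2Isomorphic {α β : Type*} [Fintype α] [DecidableEq α] [Fintype β] [DecidableEq β]
    (ν : α → α) (K : PreAbstractSimplicialComplex α)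
    (μ : β → β) (L : PreAbstractSimplicialComplex β) : Prop :=
  IsSimplicialZ2Space ν K ∧ IsSimplicialZ2Space μ L ∧
    ∃ f : α → β, Set.InjOn f (complexVertices K) ∧ K.map f = L ∧
      ∀ v ∈ complexVertices K, f (ν v) = μ (f v)

/-- The subspace `A` is a strong `ℤ₂`-deformation retract of the `ℤ₂`-space `(X, ν)`: there is a
homotopy `F : [0, 1] × X → X` from the identity of `X` to a retraction of `X` onto `A` that fixes
`A` pointwise and is equivariant at all times. -/
def IsStrongZ2DeformationRetract {E : Type*} [TopologicalSpace E]
    (ν : E → E) (A X : Set E) : Prop :=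
  IsZ2Space ν X ∧ A ⊆ X ∧ Set.MapsTo ν A A ∧
    ∃ F : ℝ × E → E,
      ContinuousOn F (Set.Icc (0 : ℝ) 1 ×ˢ X) ∧
      (∀ t ∈ Set.Icc (0 : ℝ) 1, ∀ x ∈ X, F (t, x) ∈ X) ∧
      (∀ x ∈ X, F (0, x) = x) ∧
      (∀ x ∈ X, F (1, x) ∈ A) ∧
      (∀ t ∈ Set.Icc (0 : ℝ) 1, ∀ a ∈ A, F (t, a) = a) ∧
      (∀ t ∈ Set.Icc (0 : ℝ) 1, ∀ x ∈ X, F (t, ν x) = ν (F (t, x)))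

/-! ### Subdivisions -/

/-- The barycentric subdivision: its simplices are the nonempty chains of faces. -/
def barycentricSubdivision {α : Type*} (K : PreAbstractSimplicialComplex α) :
    PreAbstractSimplicialComplex (Finset α) where
  faces := {τ | τ.Nonempty ∧ (∀ s ∈ τ, s ∈ K.faces) ∧ IsChain (· ⊆ ·) (τ : Set (Finset α))}
  isRelLowerSet_faces := fun _ hτ => ⟨hτ.1, fun _ hρ hne => by
    obtain ⟨-, hK, hc⟩ := hτ
    exact ⟨hne, fun s hs => hK s (hρ hs), hc.mono (Finset.coe_subset.2 hρ)⟩⟩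

/-- The subcomplex induced by a set of vertices. -/
def inducedSubcomplex {α : Type*} (K : PreAbstractSimplicialComplex α) (S : Set α) :
    PreAbstractSimplicialComplex α where
  faces := {σ | σ ∈ K.faces ∧ ∀ v ∈ σ, v ∈ S}
  isRelLowerSet_faces := fun _ hσ => ⟨(K.isRelLowerSet_faces hσ.1).1, fun _ hρ hne =>
    ⟨(K.isRelLowerSet_faces hσ.1).2 hρ hne, fun v hv => hσ.2 v (hρ hv)⟩⟩

/-- The shore subdivision of a complex whose vertex set is partitioned into two parts, the left and
the right summand of `α ⊕ β`: the union over the faces `σ` of the joins of the barycentric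
subdivisions of the two simplices `σ.toLeft` and `σ.toRight`. The vertex `Sum.inl A` is `A ⊎ ∅` and
the vertex `Sum.inr B` is `∅ ⊎ B`. -/
def shoreSubdivision {α β : Type*} (K : PreAbstractSimplicialComplex (α ⊕ β)) :
    PreAbstractSimplicialComplex (Finset α ⊕ Finset β) where
  faces := {τ | τ.Nonempty ∧
    IsChain (· ⊆ ·) (τ.toLeft : Set (Finset α)) ∧
    IsChain (· ⊆ ·) (τ.toRight : Set (Finset β)) ∧
    ∃ σ ∈ K.faces, (∀ A ∈ τ.toLeft, A.Nonempty ∧ A ⊆ σ.toLeft) ∧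
      (∀ B ∈ τ.toRight, B.Nonempty ∧ B ⊆ σ.toRight)}
  isRelLowerSet_faces := fun _ hτ => ⟨hτ.1, fun _ hρ hne => by
    obtain ⟨-, hl, hr, σ, hσ, hA, hB⟩ := hτ
    refine ⟨hne, hl.mono (Finset.coe_subset.2 (Finset.toLeft_subset_toLeft hρ)),
      hr.mono (Finset.coe_subset.2 (Finset.toRight_subset_toRight hρ)), σ, hσ,
      fun A h => hA A (Finset.toLeft_subset_toLeft hρ h),
      fun B h => hB B (Finset.toRight_subset_toRight hρ h)⟩⟩

/-- The canonical map `‖ssd K‖ → ‖K‖`: the affine extension of the map that sends the vertices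
`A ⊎ ∅` and `∅ ⊎ B` of the shore subdivision to the barycenters of `A` and `B`. -/
noncomputable def subdivisionMap {α β : Type*} [Fintype α] [DecidableEq α] [Fintype β]
    [DecidableEq β] (y : Finset α ⊕ Finset β → ℝ) : α ⊕ β → ℝ :=
  Sum.elim
    (fun a => ∑ A ∈ Finset.univ.filter (fun A : Finset α => a ∈ A), y (Sum.inl A) / (A.card : ℝ))
    (fun b => ∑ B ∈ Finset.univ.filter (fun B : Finset β => b ∈ B), y (Sum.inr B) / (B.card : ℝ))

/-! ### The complexes of a graph -/

section Graph

variable {V : Type*} [Fintype V]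

open Classical in
/-- The common neighborhood `CN(A)`; in particular `CN(∅)` is the set of all nodes. -/
noncomputable def commonNbhd (G : SimpleGraph V) (A : Finset V) : Finset V :=
  Finset.univ.filter (fun v => ∀ a ∈ A, G.Adj a v)

theorem commonNbhd_anti (G : SimpleGraph V) {A B : Finset V} (h : A ⊆ B) :
    commonNbhd G B ⊆ commonNbhd G A := by
  intro v hv
  simp only [commonNbhd, Finset.mem_filter, Finset.mem_univ, true_and] at hv ⊢
  exact fun a ha => hv a (h ha)

/-- The neighborhood complex. -/
def neighborhoodComplex (G : SimpleGraph V) : PreAbstractSimplicialComplex V where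
  faces := {A | A.Nonempty ∧ (commonNbhd G A).Nonempty}
  isRelLowerSet_faces := fun _ hA => ⟨hA.1, fun _ hB hne =>
    ⟨hne, hA.2.mono (commonNbhd_anti G hB)⟩⟩

/-- The Lovász complex: the subcomplex of the barycentric subdivision of the neighborhood complex
induced by the fixed points of `CN²`. Its `ℤ₂`-action is `CN`. -/
def lovaszComplex (G : SimpleGraph V) : PreAbstractSimplicialComplex (Finset V) :=
  inducedSubcomplex (barycentricSubdivision (neighborhoodComplex G))
    {A | commonNbhd G (commonNbhd G A) = A}

/-- The box complex: the simplices are the `A ⊎ B` such that `A` and `B` have nonempty common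
neighborhoods and all nodes of `A` are adjacent to all nodes of `B`. The `ℤ₂`-action `Sum.swap`
interchanges the shores. -/
def boxComplex (G : SimpleGraph V) : PreAbstractSimplicialComplex (V ⊕ V) where
  faces := {σ | σ.Nonempty ∧
    (commonNbhd G σ.toLeft).Nonempty ∧ (commonNbhd G σ.toRight).Nonempty ∧
    ∀ a ∈ σ.toLeft, ∀ b ∈ σ.toRight, G.Adj a b}
  isRelLowerSet_faces := fun _ hσ => ⟨hσ.1, fun _ hρ hne =>
    ⟨hne, hσ.2.1.mono (commonNbhd_anti G (Finset.toLeft_subset_toLeft hρ)),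
      hσ.2.2.1.mono (commonNbhd_anti G (Finset.toRight_subset_toRight hρ)),
      fun a ha b hb => hσ.2.2.2 a (Finset.toLeft_subset_toLeft hρ ha) b
        (Finset.toRight_subset_toRight hρ hb)⟩⟩

/-- The vertex map `CN²` of the shore subdivision of the box complex, on each shore. -/
noncomputable def shoreClosure (G : SimpleGraph V) : Finset V ⊕ Finset V → Finset V ⊕ Finset V :=
  Sum.map (fun A => commonNbhd G (commonNbhd G A)) (fun B => commonNbhd G (commonNbhd G B))

/-- The doubled Lovász complex: the image of `CN²` on the shore subdivision of the box complex. -/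
noncomputable def doubledLovaszComplex [DecidableEq V] (G : SimpleGraph V) :
    PreAbstractSimplicialComplex (Finset V ⊕ Finset V) :=
  (shoreSubdivision (boxComplex G)).map (shoreClosure G)

open Classical in
/-- The jump map, which sends both vertices of a pair `{A ⊎ ∅, ∅ ⊎ CN(A)}` to the one whose node
set is smaller with respect to the linear order `prec` on node sets. -/
noncomputable def jumpMap (G : SimpleGraph V) (prec : Finset V → Finset V → Prop) :
    Finset V ⊕ Finset V → Finset V ⊕ Finset V :=
  Sum.elim
    (fun A => if prec (commonNbhd G A) A then Sum.inr (commonNbhd G A) else Sum.inl A)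
    (fun B => if prec (commonNbhd G B) B then Sum.inl (commonNbhd G B) else Sum.inr B)

/-- The halved doubled Lovász complex: the image of the jump map on the doubled Lovász complex. -/
noncomputable def halvedDoubledLovaszComplex [DecidableEq V] (G : SimpleGraph V)
    (prec : Finset V → Finset V → Prop) :
    PreAbstractSimplicialComplex (Finset V ⊕ Finset V) :=
  (doubledLovaszComplex G).map (jumpMap G prec)

end Graph

/-- `prec` is a strict linear order on the finite node sets that refines the partial order by
cardinality. -/
def IsCardRefinement {V : Type*} (prec : Finset V → Finset V → Prop) : Prop :=
  IsStrictTotalOrder (Finset V) prec ∧ ∀ A B : Finset V, A.card < B.card → prec A B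

/-- The order by cardinality, ties being broken lexicographically. -/
def cardLex {V : Type*} [LinearOrder V] (A B : Finset V) : Prop :=
  A.card < B.card ∨ (A.card = B.card ∧ A.sort (· ≤ ·) < B.sort (· ≤ ·))

theorem cardLex_isCardRefinement {V : Type*} [LinearOrder V] :
    IsCardRefinement (cardLex (V := V)) := by
  refine ⟨{ irrefl := ?_, trans := ?_, trichotomous := ?_ }, fun A B h => Or.inl h⟩
  · intro A B h1 h2
    simp only [cardLex, not_or, not_and, not_lt] at h1 h2
    have hc : A.card = B.card := le_antisymm h2.1 h1.1
    have hs : A.sort (· ≤ ·) = B.sort (· ≤ ·) := le_antisymm (h2.2 hc.symm) (h1.2 hc)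
    rw [← Finset.sort_toFinset A (· ≤ ·), hs, Finset.sort_toFinset]
  · intro A h
    rcases h with h | ⟨-, h⟩
    · exact lt_irrefl _ h
    · exact lt_irrefl _ h
  · intro A B C h1 h2
    rcases h1 with h1 | ⟨h1, h1'⟩ <;> rcases h2 with h2 | ⟨h2, h2'⟩
    · exact Or.inl (h1.trans h2)
    · exact Or.inl (h2 ▸ h1)
    · exact Or.inl (h1 ▸ h2)
    · exact Or.inr ⟨h1.trans h2, h1'.trans h2'⟩

/-! The three retractions rest on two facts.

First, the shore subdivision of the box complex is a flag complex
(`mem_shoreSubdivision_boxComplex`): a set of vertices is a simplex as soon as sets on the same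
shore are nested and sets `A`, `B` on different shores satisfy `B ⊆ CN(A)`. Hence simpliciality of
any vertex map can be tested on pairs of vertices.

Second, a vertex map `f` for which `σ ∪ f(σ)` need not be a simplex is still homotopic to the
identity if it can be applied to the larger sets first. The homotopy is `sweep`: stack the mass of
a point `x` of the realization along the order of inclusion on each shore, and at time `t` transport
the part of the mass within distance `t` of the top along `f`. The formula is a minimum of maxima of
linear functions, so it is continuous on the whole ambient space; it is visibly equivariant, fixes
the points supported on fixed vertices, and at time `1` is the affine extension of `f`. It stays in
the complex if `D ∪ f(U)` is a simplex whenever `D ∪ U` is one in which no vertex of `U` lies below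
a vertex of `D` (`isStrongZ2DeformationRetract_map`). For `f = CN²` this holds because `A ⊆ B`
implies `A ⊆ CN²(B)`. For the jump map it holds because the sets that jump are upward closed on each
shore, and because sets on both shores of one simplex never jump together
(`IsCardRefinement.not_prec_of_joined`).

The complex `HDL(G)` is isomorphic to `L(G)` because each simplex of `DL(G)` becomes a chain of
closed sets when `CN` moves its right shore to the left, and the jump map does not distinguish
`∅ ⊎ B` from `CN(B) ⊎ ∅`. Finally `‖ssd K‖ → ‖K‖` is a continuous bijection of compact Hausdorff
spaces: on each shore a nonnegative vector is in a unique way a nonnegative combination of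
indicators of a chain of nonempty sets (`exists_chain_weights`, `chain_weights_unique`). -/

/-! ### Affine extensions of vertex maps and free involutions -/

section Realization

variable {α β γ : Type*} [Fintype α] [DecidableEq β]

theorem continuous_geomMap (f : α → β) : Continuous (geomMap f) := by
  unfold geomMap
  fun_prop

theorem geomMap_nonneg (f : α → β) {x : α → ℝ} (hx : ∀ a, 0 ≤ x a) (b : β) :
    0 ≤ geomMap f x b :=
  Finset.sum_nonneg fun a _ => hx a

theorem geomMap_ne_zero_iff (f : α → β) {x : α → ℝ} (hx : ∀ a, 0 ≤ x a) (b : β) :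
    geomMap f x b ≠ 0 ↔ ∃ a, x a ≠ 0 ∧ f a = b := by
  rw [geomMap, Ne, Finset.sum_eq_zero_iff_of_nonneg fun a _ => hx a]
  simp [and_comm]

theorem sum_geomMap [Fintype β] (f : α → β) (x : α → ℝ) : ∑ b, geomMap f x b = ∑ a, x a :=
  Finset.sum_fiberwise Finset.univ f x

theorem geomMap_geomMap [Fintype β] [DecidableEq γ] (f : α → β) (g : β → γ) (x : α → ℝ) :
    geomMap g (geomMap f x) = geomMap (g ∘ f) x := by
  funext c
  simp only [geomMap, Finset.sum_filter, Function.comp_apply]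
  rw [← Finset.sum_filter, Finset.sum_comm]
  exact Finset.sum_congr rfl fun a _ => by simp [Finset.sum_ite_eq]

theorem geomMap_eq_self [DecidableEq α] {f : α → α} {x : α → ℝ}
    (h : ∀ a, x a ≠ 0 → f a = a) : geomMap f x = x := by
  funext b
  rw [geomMap, Finset.sum_filter, Finset.sum_eq_single b]
  · split_ifs with hb
    · rfl
    · by_contra h0
      exact hb (h b (Ne.symm h0))
  · intro a _ hab
    split_ifs with hf
    · by_contra h0
      exact hab ((h a h0).symm.trans hf)
    · rfl
  · simp

theorem geomMap_of_involutive [DecidableEq α] {ν : α → α} (hν : Function.Involutive ν)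
    (x : α → ℝ) : geomMap ν x = x ∘ ν := by
  funext b
  have : Finset.univ.filter (fun a => ν a = b) = {ν b} := by
    ext a
    simp only [Finset.mem_filter, Finset.mem_univ, true_and, Finset.mem_singleton]
    exact ⟨fun h => by rw [← h, hν], fun h => by rw [h, hν]⟩
  simp [geomMap, this]

theorem support_geomMap [Fintype β] (f : α → β) {x : α → ℝ} (hx : ∀ a, 0 ≤ x a) :
    Finset.univ.filter (fun b => geomMap f x b ≠ 0) =
      (Finset.univ.filter fun a => x a ≠ 0).image f := by
  ext b
  simp [geomMap_ne_zero_iff f hx]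

theorem geomMap_mem_geomRealization [Fintype β] {K : PreAbstractSimplicialComplex α}
    {L : PreAbstractSimplicialComplex β} {f : α → β}
    (h : ∀ σ ∈ K.faces, σ.image f ∈ L.faces) {x : α → ℝ} (hx : x ∈ geomRealization K) :
    geomMap f x ∈ geomRealization L := by
  obtain ⟨⟨h0, h1⟩, hs⟩ := hx
  refine ⟨⟨geomMap_nonneg f h0, (sum_geomMap f x).trans h1⟩, ?_⟩
  rw [support_geomMap f h0]
  exact h _ hs

/-- A simplicial map that is an involution on vertices and moves no vertex of a face into the same
face acts freely on the realization: the support of a fixed point would be an invariant face. -/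
theorem isSimplicialZ2Space_of_disjoint [DecidableEq α] {K : PreAbstractSimplicialComplex α}
    {ν : α → α} (hν : ∀ σ ∈ K.faces, σ.image ν ∈ K.faces)
    (hinv : ∀ σ ∈ K.faces, ∀ a ∈ σ, ν (ν a) = a) (hfree : ∀ σ ∈ K.faces, ∀ a ∈ σ, ν a ∉ σ) :
    IsSimplicialZ2Space ν K := by
  refine ⟨hν, fun x hx => geomMap_mem_geomRealization hν hx, (continuous_geomMap ν).continuousOn,
    fun x hx => ?_, fun x hx hfix => ?_⟩
  · rw [geomMap_geomMap]
    exact geomMap_eq_self fun a ha => hinv _ hx.2 a (by simpa using ha)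
  · obtain ⟨a, ha⟩ := (K.isRelLowerSet_faces hx.2).1
    refine hfree _ hx.2 a ha ?_
    have := support_geomMap ν hx.1.1
    rw [hfix] at this
    rw [this]
    exact Finset.mem_image_of_mem ν ha

theorem geomRealization_mono {K L : PreAbstractSimplicialComplex α} (h : K.faces ⊆ L.faces) :
    geomRealization K ⊆ geomRealization L :=
  fun _ hx => ⟨hx.1, h hx.2⟩

/-- The support need only be contained in a face: it is nonempty because the coordinates of `x` add
up to `1`. -/
theorem mem_geomRealization_of_subset {K : PreAbstractSimplicialComplex α} {σ : Finset α}
    (hσ : σ ∈ K.faces) {x : α → ℝ} (hx : x ∈ stdSimplex ℝ α) (h : ∀ a, x a ≠ 0 → a ∈ σ) :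
    x ∈ geomRealization K := by
  refine ⟨hx, (K.isRelLowerSet_faces hσ).2 (fun a ha => h a (by simpa using ha)) ?_⟩
  by_contra hne
  rw [Finset.not_nonempty_iff_eq_empty, Finset.filter_eq_empty_iff] at hne
  have : ∑ a, x a = 0 := Finset.sum_eq_zero fun a ha => by simpa using hne ha
  linarith [hx.2]

theorem isCompact_geomRealization (K : PreAbstractSimplicialComplex α) :
    IsCompact (geomRealization K) := by
  have : geomRealization K =
      ⋃ σ ∈ K.faces, stdSimplex ℝ α ∩ {x | ∀ a, a ∉ σ → x a = 0} := by
    ext x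
    simp only [Set.mem_iUnion, exists_prop]
    constructor
    · intro hx
      exact ⟨_, hx.2, hx.1, fun a ha => by simpa using ha⟩
    · rintro ⟨σ, hσ, hx, h⟩
      exact mem_geomRealization_of_subset hσ hx fun a ha => by
        by_contra hn
        exact ha (h a hn)
  rw [this]
  refine (Set.toFinite _).isCompact_biUnion fun σ _ => (isCompact_stdSimplex ℝ α).inter_right ?_
  simp only [Set.ofPred_forall]
  exact isClosed_iInter fun a => isClosed_iInter fun _ =>
    isClosed_eq (continuous_apply a) continuous_const

end Realization

/-! ### The sweep homotopy -/

section Sweep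

open Classical in
/-- The part of the mass `x a` that lies, when the total mass of `x` is stacked along the order,
within distance `t` of the top: the mass strictly above `a` uses up the first part of `t`. -/
noncomputable def sweptMass {α : Type*} [Fintype α] [PartialOrder α] (t : ℝ) (x : α → ℝ) :
    α → ℝ :=
  fun a => min (x a) (max 0 (t - ∑ b ∈ Finset.univ.filter (fun b => a < b), x b))

/-- The homotopy that transports the top `t` units of the mass of `x` along the vertex map `f`. -/
noncomputable def sweep {α : Type*} [Fintype α] [DecidableEq α] [PartialOrder α] (f : α → α)
    (t : ℝ) (x : α → ℝ) : α → ℝ :=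
  fun b => x b - sweptMass t x b + geomMap f (sweptMass t x) b

variable {α : Type*} [Fintype α] [PartialOrder α]

theorem continuous_sweep [DecidableEq α] (f : α → α) :
    Continuous fun p : ℝ × (α → ℝ) => sweep f p.1 p.2 := by
  have h : Continuous fun p : ℝ × (α → ℝ) => sweptMass p.1 p.2 := by
    unfold sweptMass
    fun_prop
  have h' := (continuous_geomMap f).comp h
  refine continuous_pi fun b => ?_
  exact (((continuous_apply b).comp continuous_snd).sub ((continuous_apply b).comp h)).add
    ((continuous_apply b).comp h')

theorem sweptMass_le (t : ℝ) (x : α → ℝ) (a : α) : sweptMass t x a ≤ x a :=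
  min_le_left _ _

theorem sweptMass_nonneg (t : ℝ) {x : α → ℝ} (hx : ∀ a, 0 ≤ x a) (a : α) :
    0 ≤ sweptMass t x a :=
  le_min (hx a) (le_max_left _ _)

theorem sweptMass_zero {x : α → ℝ} (hx : ∀ a, 0 ≤ x a) : sweptMass 0 x = 0 := by
  classical
  funext a
  have := Finset.sum_nonneg fun b (_ : b ∈ Finset.univ.filter (fun b => a < b)) => hx b
  have h2 : max 0 (0 - ∑ b ∈ Finset.univ.filter (fun b => a < b), x b) = 0 :=
    max_eq_left (by linarith)
  exact (congrArg (min (x a)) h2).trans (min_eq_right (hx a))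

theorem sweptMass_one {x : α → ℝ} (hx : x ∈ stdSimplex ℝ α) : sweptMass 1 x = x := by
  classical
  funext a
  refine min_eq_left (le_max_of_le_right ?_)
  have : ∑ b ∈ insert a (Finset.univ.filter (fun b => a < b)), x b ≤ 1 :=
    (Finset.sum_le_univ_sum_of_nonneg hx.1).trans hx.2.le
  rw [Finset.sum_insert (by simp)] at this
  exact le_sub_iff_add_le.2 this

/-- Mass is swept from the top: when `a` loses mass, everything above `a` is already gone. -/
theorem not_lt_of_sweptMass {t : ℝ} {x : α → ℝ} (hx : ∀ a, 0 ≤ x a) {a b : α}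
    (ha : 0 < sweptMass t x a) (hb : sweptMass t x b < x b) : ¬a < b := by
  classical
  intro hab
  rw [sweptMass, lt_min_iff, lt_max_iff] at ha
  have ha' := ha.2.resolve_left (lt_irrefl _)
  rw [sweptMass, min_lt_iff, max_lt_iff] at hb
  have hb' := (hb.resolve_left (lt_irrefl _)).2
  have hsub : insert b (Finset.univ.filter fun c => b < c) ⊆ Finset.univ.filter fun c => a < c := by
    intro c hc
    simp only [Finset.mem_insert, Finset.mem_filter, Finset.mem_univ, true_and] at hc ⊢
    rcases hc with rfl | hc
    exacts [hab, hab.trans hc]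
  have := Finset.sum_le_sum_of_subset_of_nonneg hsub fun c _ _ => hx c
  rw [Finset.sum_insert (by simp)] at this
  linarith

theorem sweptMass_comp {ν : α → α} (hν : Function.Involutive ν) (hmono : StrictMono ν)
    (t : ℝ) (x : α → ℝ) : sweptMass t (x ∘ ν) = sweptMass t x ∘ ν := by
  classical
  funext a
  simp only [sweptMass, Function.comp_apply]
  have : ∑ b ∈ Finset.univ.filter (fun b => a < b), x (ν b) =
      ∑ b ∈ Finset.univ.filter (fun b => ν a < b), x b := by
    refine Finset.sum_nbij' ν ν ?_ ?_ (fun b _ => hν b) (fun b _ => hν b) (fun _ _ => rfl)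
    · intro b hb
      simpa using hmono (by simpa using hb)
    · intro b hb
      have := hmono (a := ν a) (b := b) (by simpa using hb)
      rw [hν] at this
      simpa using this
  congr 3

variable [DecidableEq α]

theorem sweep_zero (f : α → α) {x : α → ℝ} (hx : ∀ a, 0 ≤ x a) : sweep f 0 x = x := by
  funext b
  simp [sweep, sweptMass_zero hx, geomMap]

theorem sweep_one (f : α → α) {x : α → ℝ} (hx : x ∈ stdSimplex ℝ α) :
    sweep f 1 x = geomMap f x := by
  funext b
  simp [sweep, sweptMass_one hx]

theorem sweep_mem_stdSimplex (f : α → α) (t : ℝ) {x : α → ℝ} (hx : x ∈ stdSimplex ℝ α) :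
    sweep f t x ∈ stdSimplex ℝ α := by
  refine ⟨fun b => add_nonneg (sub_nonneg.2 (sweptMass_le t x b))
    (geomMap_nonneg f (sweptMass_nonneg t hx.1) b), ?_⟩
  simp only [sweep, Finset.sum_add_distrib, Finset.sum_sub_distrib, sum_geomMap]
  linarith [hx.2]

theorem sweep_eq_self (f : α → α) (t : ℝ) {x : α → ℝ} (hx : ∀ a, 0 ≤ x a)
    (h : ∀ a, x a ≠ 0 → f a = a) : sweep f t x = x := by
  have : geomMap f (sweptMass t x) = sweptMass t x := geomMap_eq_self fun a ha => h a fun h0 =>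
    ha (le_antisymm ((sweptMass_le t x a).trans h0.le) (sweptMass_nonneg t hx a))
  funext b
  simp [sweep, this]

theorem sweep_mem_geomRealization {K : PreAbstractSimplicialComplex α} {f : α → α}
    (hK : ∀ D U : Finset α, D ∪ U ∈ K.faces → (∀ a ∈ U, ∀ b ∈ D, ¬a < b) →
      D ∪ U.image f ∈ K.faces) (t : ℝ) {x : α → ℝ} (hx : x ∈ geomRealization K) :
    sweep f t x ∈ geomRealization K := by
  classical
  have h0 := hx.1.1
  set D := Finset.univ.filter fun a => sweptMass t x a < x a with hD
  set U := Finset.univ.filter fun a => 0 < sweptMass t x a with hU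
  have hDU : D ∪ U = Finset.univ.filter fun a => x a ≠ 0 := by
    ext a
    have h1 := sweptMass_le t x a
    have h2 := sweptMass_nonneg t h0 a
    simp only [hD, hU, Finset.mem_union, Finset.mem_filter, Finset.mem_univ, true_and]
    constructor
    · rintro (h | h)
      exacts [(h2.trans_lt h).ne', (h.trans_le h1).ne']
    · intro h
      by_cases h3 : sweptMass t x a < x a
      · exact Or.inl h3
      · exact Or.inr (((h0 a).lt_of_ne' h).trans_le (not_lt.1 h3))
  refine mem_geomRealization_of_subset (hK D U ?_ ?_) (sweep_mem_stdSimplex f t hx.1) ?_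
  · rw [hDU]
    convert hx.2
  · intro a ha b hb
    exact not_lt_of_sweptMass h0 (by simpa [hU] using ha) (by simpa [hD] using hb)
  · intro b hb
    by_contra hn
    simp only [Finset.mem_union, Finset.mem_image, not_or, hD, hU, Finset.mem_filter,
      Finset.mem_univ, true_and, not_lt] at hn
    have h1 : geomMap f (sweptMass t x) b = 0 := by
      by_contra h
      obtain ⟨a, ha, hab⟩ := (geomMap_ne_zero_iff f (sweptMass_nonneg t h0) b).1 h
      exact hn.2 ⟨a, (sweptMass_nonneg t h0 a).lt_of_ne' ha, hab⟩
    refine hb ?_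
    rw [sweep, h1]
    linarith [sweptMass_le t x b, hn.1]

/-- If sweeping the upper part `U` of a face along an idempotent vertex map `f` always yields a
face, then the sweep homotopy retracts the complex onto its image under `f`. -/
theorem isStrongZ2DeformationRetract_map {K : PreAbstractSimplicialComplex α} {f ν : α → α}
    (hZ : IsSimplicialZ2Space ν K) (hν : Function.Involutive ν) (hmono : StrictMono ν)
    (hcomm : ∀ a, f (ν a) = ν (f a)) (hidem : ∀ σ ∈ K.faces, ∀ a ∈ σ, f (f a) = f a)
    (hK : ∀ D U : Finset α, D ∪ U ∈ K.faces → (∀ a ∈ U, ∀ b ∈ D, ¬a < b) →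
      D ∪ U.image f ∈ K.faces) :
    IsStrongZ2DeformationRetract (geomMap ν) (geomRealization (K.map f)) (geomRealization K) := by
  have hsub : (K.map f).faces ⊆ K.faces := by
    rintro _ ⟨σ, hσ, rfl⟩
    simpa using hK ∅ σ (by simpa using hσ) (by simp)
  refine ⟨hZ.2, geomRealization_mono hsub, fun x hx => geomMap_mem_geomRealization ?_ hx,
    fun p => sweep f p.1 p.2, (continuous_sweep f).continuousOn,
    fun t _ x hx => sweep_mem_geomRealization hK t hx, fun x hx => sweep_zero f hx.1.1,
    fun x hx => ?_, fun t _ x hx => sweep_eq_self f t hx.1.1 ?_, fun t _ x hx => ?_⟩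
  · rintro _ ⟨σ, hσ, rfl⟩
    refine ⟨σ.image ν, hZ.1 σ hσ, ?_⟩
    simp only [Finset.image_image]
    exact Finset.image_congr fun a _ => hcomm a
  · change sweep f 1 x ∈ _
    rw [sweep_one f hx.1]
    exact geomMap_mem_geomRealization (fun σ hσ => Set.mem_image_of_mem _ hσ) hx
  · intro b hb
    obtain ⟨σ, hσ, hσx⟩ := hx.2
    have : b ∈ σ.image f := by
      change σ.image f = _ at hσx
      rw [hσx]
      simpa using hb
    obtain ⟨a, ha, rfl⟩ := Finset.mem_image.1 this
    exact hidem σ hσ a ha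
  · change sweep f t (geomMap ν x) = geomMap ν (sweep f t x)
    rw [geomMap_of_involutive hν, geomMap_of_involutive hν]
    funext b
    simp only [sweep, Function.comp_apply, sweptMass_comp hν hmono]
    congr 1
    have : ∀ y : α → ℝ, geomMap f (y ∘ ν) b = geomMap f y (ν b) := fun y => by
      rw [← geomMap_of_involutive hν, geomMap_geomMap, ← Function.comp_apply (f := geomMap f y),
        ← geomMap_of_involutive hν, geomMap_geomMap]
      congr 1
      funext a
      exact hcomm a
    exact this _

end Sweep

/-! ### Composition and transport of strong `ℤ₂`-deformation retractions -/

section Retract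

variable {E E' : Type*} [TopologicalSpace E] [TopologicalSpace E']

theorem IsStrongZ2DeformationRetract.trans {ν : E → E} {A B X : Set E}
    (hAB : IsStrongZ2DeformationRetract ν A B) (hBX : IsStrongZ2DeformationRetract ν B X) :
    IsStrongZ2DeformationRetract ν A X := by
  obtain ⟨-, hAB', hνA, G, hGc, hGB, hG0, hG1, hGA, hGν⟩ := hAB
  obtain ⟨hZ, hBX', hνB, F, hFc, hFX, hF0, hF1, hFB, hFν⟩ := hBX
  have one_mem : (1 : ℝ) ∈ Set.Icc (0 : ℝ) 1 := ⟨zero_le_one, le_rfl⟩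
  have hmin : ∀ t ∈ Set.Icc (0 : ℝ) 1, min 1 (2 * t) ∈ Set.Icc (0 : ℝ) 1 := fun t ht =>
    ⟨le_min zero_le_one (by linarith [ht.1]), min_le_left _ _⟩
  have hmax : ∀ t ∈ Set.Icc (0 : ℝ) 1, max 0 (2 * t - 1) ∈ Set.Icc (0 : ℝ) 1 := fun t ht =>
    ⟨le_max_left _ _, max_le zero_le_one (by linarith [ht.2])⟩
  refine ⟨hZ, hAB'.trans hBX', hνA, fun p => if p.1 ≤ 1 / 2 then F (min 1 (2 * p.1), p.2)
    else G (max 0 (2 * p.1 - 1), F (1, p.2)), ?_, ?_, ?_, ?_, ?_, ?_⟩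
  · -- Both branches are continuous on all of `[0, 1] × X` and agree for `t = 1 / 2`.
    rw [continuousOn_iff_continuous_domRestrict]
    have h1 : ContinuousOn (fun p : ℝ × E => F (min 1 (2 * p.1), p.2)) (Set.Icc 0 1 ×ˢ X) :=
      hFc.comp (by fun_prop) fun p hp => ⟨hmin _ hp.1, hp.2⟩
    have h2 : ContinuousOn (fun p : ℝ × E => F (1, p.2)) (Set.Icc 0 1 ×ˢ X) :=
      hFc.comp (by fun_prop) fun p hp => ⟨one_mem, hp.2⟩
    have h3 : ContinuousOn (fun p : ℝ × E => G (max 0 (2 * p.1 - 1), F (1, p.2)))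
        (Set.Icc 0 1 ×ˢ X) :=
      hGc.comp (ContinuousOn.prodMk (by fun_prop) h2) fun p hp => ⟨hmax _ hp.1, hF1 _ hp.2⟩
    refine Continuous.if_le h1.domRestrict h3.domRestrict
      (continuous_fst.comp continuous_subtype_val) continuous_const ?_
    rintro ⟨⟨t, x⟩, ht, hx⟩ (rfl : t = 1 / 2)
    norm_num [Set.domRestrict]
    exact (hG0 _ (hF1 _ hx)).symm
  · intro t ht x hx
    dsimp only
    split_ifs
    · exact hFX _ (hmin t ht) x hx
    · exact hBX' (hGB _ (hmax t ht) _ (hF1 x hx))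
  · intro x hx
    norm_num
    exact hF0 x hx
  · intro x hx
    norm_num
    exact hG1 _ (hF1 x hx)
  · intro t ht a ha
    dsimp only
    split_ifs
    · exact hFB _ (hmin t ht) a (hAB' ha)
    · rw [hFB 1 one_mem a (hAB' ha)]
      exact hGA _ (hmax t ht) a ha
  · intro t ht x hx
    dsimp only
    split_ifs
    · exact hFν _ (hmin t ht) x hx
    · rw [hFν 1 one_mem x hx]
      exact hGν _ (hmax t ht) _ (hF1 x hx)

theorem IsStrongZ2DeformationRetract.image_homeomorph {ν : E → E} {μ : E' → E'} {A X : Set E}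
    {Y : Set E'} (h : IsStrongZ2DeformationRetract ν A X) (hY : IsZ2Space μ Y) (e : X ≃ₜ Y)
    {φ : E → E'} (he : ∀ x, (e x : E') = φ x) (hφ : ∀ x ∈ X, φ (ν x) = μ (φ x)) :
    IsStrongZ2DeformationRetract μ (φ '' A) Y := by
  classical
  obtain ⟨hZ, hAX, hνA, F, hFc, hFX, hF0, hF1, hFA, hFν⟩ := h
  have hs : ∀ y : Y, φ (e.symm y) = y := fun y => by rw [← he, e.apply_symm_apply]
  have hsymm : ∀ (x : E) (hx : x ∈ X) (y : Y), φ x = y → (e.symm y : E) = x := by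
    intro x hx y hxy
    have : e ⟨x, hx⟩ = y := Subtype.ext ((he _).trans hxy)
    rw [← this, e.symm_apply_apply]
  refine ⟨hY, ?_, ?_, fun p => if hp : p.2 ∈ Y then φ (F (p.1, e.symm ⟨p.2, hp⟩)) else p.2,
    ?_, ?_, ?_, ?_, ?_, ?_⟩
  · rintro _ ⟨x, hx, rfl⟩
    rw [← he ⟨x, hAX hx⟩]
    exact (e _).2
  · rintro _ ⟨x, hx, rfl⟩
    exact ⟨ν x, hνA hx, hφ x (hAX hx)⟩
  · rw [continuousOn_iff_continuous_domRestrict]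
    have hφc : ContinuousOn φ X := by
      rw [continuousOn_iff_continuous_domRestrict]
      exact (continuous_subtype_val.comp e.continuous).congr he
    let g : (Set.Icc (0 : ℝ) 1 ×ˢ Y : Set (ℝ × E')) → ℝ × E :=
      fun p => (p.1.1, e.symm ⟨p.1.2, p.2.2⟩)
    have hg : Continuous g := by
      refine (continuous_fst.comp continuous_subtype_val).prodMk
        (continuous_subtype_val.comp (e.symm.continuous.comp ?_))
      exact (continuous_snd.comp continuous_subtype_val).subtype_mk _
    have hgm : ∀ p, g p ∈ Set.Icc (0 : ℝ) 1 ×ˢ X := fun p => ⟨p.2.1, Subtype.coe_prop _⟩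
    have := hφc.comp_continuous (hFc.comp_continuous hg hgm)
      fun p => hFX _ (hgm p).1 _ (hgm p).2
    refine this.congr fun p => ?_
    simp [g, p.2.2]
  · intro t ht y hy
    have := hFX t ht _ (e.symm ⟨y, hy⟩).2
    simp only [hy, dite_true]
    rw [← he ⟨_, this⟩]
    exact (e _).2
  · intro y hy
    simp only [hy, dite_true, hF0 _ (e.symm ⟨y, hy⟩).2, hs]
  · intro y hy
    simp only [hy, dite_true]
    exact Set.mem_image_of_mem φ (hF1 _ (e.symm ⟨y, hy⟩).2)
  · rintro t ht _ ⟨a, ha, rfl⟩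
    have hy : φ a ∈ Y := by
      rw [← he ⟨a, hAX ha⟩]
      exact (e _).2
    simp only [hy, dite_true, hsymm a (hAX ha) ⟨φ a, hy⟩ rfl, hFA t ht a ha]
  · intro t ht y hy
    have hx := (e.symm ⟨y, hy⟩).2
    have hμ : (e.symm ⟨μ y, hY.1 hy⟩ : E) = ν (e.symm ⟨y, hy⟩) :=
      hsymm _ (hZ.1 hx) _ (by rw [hφ _ hx, hs])
    simp only [hy, hY.1 hy, dite_true, hμ]
    rw [hFν t ht _ hx, hφ _ (hFX t ht _ hx)]

end Retract

/-! ### The shore subdivision is homeomorphic to the complex -/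

section Subdivision

variable {α : Type*} [Fintype α] [DecidableEq α]

/-- For weights `z` on a chain of sets, the total weight of the sets containing `A` is the minimum
over `A` of the point that `z` represents. It is attained outside the largest set of the chain that
does not contain `A`. -/
theorem exists_sum_superset_eq {z : Finset α → ℝ}
    (hc : ∀ B C, z B ≠ 0 → z C ≠ 0 → B ⊆ C ∨ C ⊆ B) {A : Finset α} (hA : A.Nonempty) :
    ∃ a ∈ A, ∑ C ∈ Finset.univ.filter (fun C => A ⊆ C), z C =
      ∑ C ∈ Finset.univ.filter (fun C => a ∈ C), z C := by
  set S := Finset.univ.filter fun C : Finset α => z C ≠ 0 ∧ ¬A ⊆ C with hS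
  obtain ⟨a, ha, haS⟩ : ∃ a ∈ A, ∀ C ∈ S, a ∉ C := by
    rcases S.eq_empty_or_nonempty with h | h
    · obtain ⟨a, ha⟩ := hA
      exact ⟨a, ha, by simp [h]⟩
    · obtain ⟨D, hD, hmax⟩ := S.exists_max_image Finset.card h
      have hD' := (Finset.mem_filter.1 hD).2
      obtain ⟨a, ha, haD⟩ := Finset.not_subset.1 hD'.2
      refine ⟨a, ha, fun C hC haC => haD ?_⟩
      rcases hc C D (Finset.mem_filter.1 hC).2.1 hD'.1 with h | h
      · exact h haC
      · rwa [Finset.eq_of_subset_of_card_le h (hmax C hC)]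
  refine ⟨a, ha, Finset.sum_subset_zero_on_sdiff (fun C hC => ?_) (fun C hC => ?_)
    fun _ _ => rfl⟩
  · simp only [Finset.mem_filter, Finset.mem_univ, true_and] at hC ⊢
    exact hC ha
  · simp only [Finset.mem_sdiff, Finset.mem_filter, Finset.mem_univ, true_and] at hC
    by_contra hz
    exact haS C (by simp [hS, hz, hC.2]) hC.1

theorem sum_superset_le {z : Finset α → ℝ} (h0 : ∀ C, 0 ≤ z C) {A : Finset α} {a : α}
    (ha : a ∈ A) : ∑ C ∈ Finset.univ.filter (fun C => A ⊆ C), z C ≤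
      ∑ C ∈ Finset.univ.filter (fun C => a ∈ C), z C :=
  Finset.sum_le_sum_of_subset_of_nonneg (Finset.monotone_filter_right _ fun _ _ h => h ha)
    fun C _ _ => h0 C

/-- Nonnegative weights on a chain of nonempty sets are determined by the point they represent. -/
theorem chain_weights_unique {z w : Finset α → ℝ} (hz0 : ∀ C, 0 ≤ z C) (hw0 : ∀ C, 0 ≤ w C)
    (hz : ∀ B C, z B ≠ 0 → z C ≠ 0 → B ⊆ C ∨ C ⊆ B)
    (hw : ∀ B C, w B ≠ 0 → w C ≠ 0 → B ⊆ C ∨ C ⊆ B) (hz' : z ∅ = 0) (hw' : w ∅ = 0)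
    (h : ∀ a, ∑ C ∈ Finset.univ.filter (fun C => a ∈ C), z C =
      ∑ C ∈ Finset.univ.filter (fun C => a ∈ C), w C) : z = w := by
  have key : ∀ A : Finset α, A.Nonempty → ∑ C ∈ Finset.univ.filter (fun C => A ⊆ C), z C =
      ∑ C ∈ Finset.univ.filter (fun C => A ⊆ C), w C := by
    intro A hA
    obtain ⟨a, ha, hza⟩ := exists_sum_superset_eq hz hA
    obtain ⟨b, hb, hwb⟩ := exists_sum_superset_eq hw hA
    refine le_antisymm ?_ ?_
    · rw [hwb, ← h b]
      exact sum_superset_le hz0 hb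
    · rw [hza, h a]
      exact sum_superset_le hw0 ha
  -- The sums over supersets determine the weights, from the largest sets downwards.
  funext A
  induction A using Finset.strongDownwardInduction (n := Fintype.card α) with
  | H A ih =>
    rcases A.eq_empty_or_nonempty with rfl | hA
    · rw [hz', hw']
    · have hsplit : Finset.univ.filter (fun C => A ⊆ C) =
          insert A (Finset.univ.filter fun C => A ⊂ C) := by
        ext C
        simp only [Finset.mem_insert, Finset.mem_filter, Finset.mem_univ, true_and]
        rw [le_iff_eq_or_lt, eq_comm]
      have hk := key A hA
      have hsum := Finset.sum_congr rfl fun C (hC : C ∈ Finset.univ.filter fun C => A ⊂ C) =>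
        ih (Finset.card_le_univ C) (Finset.mem_filter.1 hC).2
      rw [hsplit, Finset.sum_insert (by simp), Finset.sum_insert (by simp), hsum] at hk
      exact add_right_cancel hk
  | _ => exact Finset.card_le_univ _

/-- Every nonnegative vector is represented by weights on a chain of nonempty subsets of its
support: subtract the largest possible multiple of the indicator of the support and iterate. -/
theorem exists_chain_weights (x : α → ℝ) (hx : ∀ a, 0 ≤ x a) :
    ∃ z : Finset α → ℝ, (∀ C, 0 ≤ z C) ∧ (∀ B C, z B ≠ 0 → z C ≠ 0 → B ⊆ C ∨ C ⊆ B) ∧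
      (∀ C, z C ≠ 0 → C.Nonempty ∧ ∀ a ∈ C, x a ≠ 0) ∧
      ∀ a, ∑ C ∈ Finset.univ.filter (fun C => a ∈ C), z C = x a := by
  induction hn : (Finset.univ.filter fun a => x a ≠ 0).card using Nat.strong_induction_on
    generalizing x with
  | _ n ih =>
    set S := Finset.univ.filter fun a => x a ≠ 0 with hS
    have memS : ∀ a, a ∈ S ↔ x a ≠ 0 := by simp [hS]
    rcases S.eq_empty_or_nonempty with h | h
    · have : ∀ a, x a = 0 := fun a => by
        by_contra ha
        simpa [h] using (memS a).2 ha
      exact ⟨0, by simp, by simp, by simp, by simp [this]⟩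
    obtain ⟨m, hmS, hmin⟩ := S.exists_min_image x h
    have hm : 0 < x m := (hx m).lt_of_ne' ((memS m).1 hmS)
    have hx'0 : ∀ a, x a - (if a ∈ S then x m else 0) ≠ 0 → x a ≠ 0 := by
      intro a ha ha0
      have : a ∉ S := fun h => (memS a).1 h ha0
      simp [this, ha0] at ha
    obtain ⟨z, hz0, hzc, hzs, hzx⟩ := ih _ (by
      rw [← hn]
      refine Finset.card_lt_card ⟨fun a ha => (memS a).2 (hx'0 a (Finset.mem_filter.1 ha).2),
        fun hsub => ?_⟩
      simpa [hmS] using hsub hmS) (fun a => x a - if a ∈ S then x m else 0) (fun a => by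
        split_ifs with ha
        · linarith [hmin a ha]
        · simpa using hx a) rfl
    have hzsub : ∀ C, z C ≠ 0 → C ⊆ S := fun C hC a ha => (memS a).2 (hx'0 a ((hzs C hC).2 a ha))
    have hval : ∀ C, z C + (if C = S then x m else 0) ≠ 0 → C = S ∨ z C ≠ 0 := by
      intro C hC
      by_cases h : C = S
      · exact Or.inl h
      · exact Or.inr (by simpa [h] using hC)
    refine ⟨fun C => z C + if C = S then x m else 0, fun C => ?_, fun B C hB hC => ?_,
      fun C hC => ?_, fun a => ?_⟩
    · exact add_nonneg (hz0 C) (by split_ifs <;> linarith)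
    · rcases hval B hB with rfl | hB <;> rcases hval C hC with rfl | hC
      · exact Or.inl subset_rfl
      · exact Or.inr (hzsub C hC)
      · exact Or.inl (hzsub B hB)
      · exact hzc B C hB hC
    · rcases hval C hC with rfl | hC
      · exact ⟨h, fun a ha => (memS a).1 ha⟩
      · exact ⟨(hzs C hC).1, fun a ha => (memS a).1 (hzsub C hC ha)⟩
    · rw [Finset.sum_add_distrib, hzx, Finset.sum_ite_eq']
      simp

theorem sum_sum_mem_div_card {y : Finset α → ℝ} (hy : y ∅ = 0) :
    ∑ a, ∑ A ∈ Finset.univ.filter (fun A => a ∈ A), y A / (A.card : ℝ) = ∑ A, y A := by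
  simp_rw [Finset.sum_filter]
  rw [Finset.sum_comm]
  refine Finset.sum_congr rfl fun A _ => ?_
  rw [← Finset.sum_filter, Finset.sum_const, Finset.filter_univ_mem, nsmul_eq_mul]
  rcases A.eq_empty_or_nonempty with rfl | hA
  · simp [hy]
  · have : (A.card : ℝ) ≠ 0 := by exact_mod_cast hA.card_pos.ne'
    field_simp

variable {β : Type*} [Fintype β] [DecidableEq β]

theorem continuous_subdivisionMap :
    Continuous (subdivisionMap : (Finset α ⊕ Finset β → ℝ) → α ⊕ β → ℝ) := by
  refine continuous_pi fun c => ?_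
  rcases c with a | b <;> simp only [subdivisionMap, Sum.elim_inl, Sum.elim_inr] <;> fun_prop

theorem sum_subdivisionMap {y : Finset α ⊕ Finset β → ℝ} (hl : y (Sum.inl ∅) = 0)
    (hr : y (Sum.inr ∅) = 0) : ∑ c, subdivisionMap y c = ∑ C, y C := by
  rw [Fintype.sum_sum_type, Fintype.sum_sum_type]
  exact congrArg₂ (· + ·) (sum_sum_mem_div_card (y := fun A => y (Sum.inl A)) hl)
    (sum_sum_mem_div_card (y := fun B => y (Sum.inr B)) hr)

theorem subdivisionMap_geomMap_swap (y : Finset α ⊕ Finset α → ℝ) :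
    subdivisionMap (geomMap Sum.swap y) = geomMap Sum.swap (subdivisionMap y) := by
  rw [geomMap_of_involutive Sum.swap_swap, geomMap_of_involutive Sum.swap_swap]
  funext c
  rcases c with a | b <;> rfl

/-- What membership in `‖ssd K‖` says about the nonzero coordinates of a point. -/
theorem shoreSubdivision_support {γ δ : Type*} [Fintype γ] [Fintype δ]
    {K : PreAbstractSimplicialComplex (γ ⊕ δ)}
    {y : Finset γ ⊕ Finset δ → ℝ} (hy : y ∈ geomRealization (shoreSubdivision K)) :
    (∀ A B, y (Sum.inl A) ≠ 0 → y (Sum.inl B) ≠ 0 → A ⊆ B ∨ B ⊆ A) ∧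
    (∀ A B, y (Sum.inr A) ≠ 0 → y (Sum.inr B) ≠ 0 → A ⊆ B ∨ B ⊆ A) ∧
    y (Sum.inl ∅) = 0 ∧ y (Sum.inr ∅) = 0 ∧
    ∃ σ ∈ K.faces, (∀ A, y (Sum.inl A) ≠ 0 → A ⊆ σ.toLeft) ∧
      ∀ B, y (Sum.inr B) ≠ 0 → B ⊆ σ.toRight := by
  obtain ⟨-, -, hl, hr, σ, hσ, hA, hB⟩ := hy
  have hl' : ∀ A, y (Sum.inl A) ≠ 0 →
      A ∈ (Finset.univ.filter fun C => y C ≠ 0).toLeft := by simp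
  have hr' : ∀ A, y (Sum.inr A) ≠ 0 →
      A ∈ (Finset.univ.filter fun C => y C ≠ 0).toRight := by simp
  refine ⟨fun A B h1 h2 => hl.total (hl' A h1) (hl' B h2),
    fun A B h1 h2 => hr.total (hr' A h1) (hr' B h2), ?_, ?_, σ, hσ,
    fun A h => (hA A (hl' A h)).2, fun B h => (hB B (hr' B h)).2⟩
  · by_contra h
    simpa using (hA _ (hl' _ h)).1
  · by_contra h
    simpa using (hB _ (hr' _ h)).1

theorem subdivisionMap_mapsTo (K : PreAbstractSimplicialComplex (α ⊕ β)) :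
    Set.MapsTo subdivisionMap (geomRealization (shoreSubdivision K)) (geomRealization K) := by
  intro y hy
  obtain ⟨-, -, hl, hr, σ, hσ, hA, hB⟩ := shoreSubdivision_support hy
  refine mem_geomRealization_of_subset hσ ⟨?_, (sum_subdivisionMap hl hr).trans hy.1.2⟩ ?_
  · rintro (a | b)
    · exact Finset.sum_nonneg fun A _ => div_nonneg (hy.1.1 _) (Nat.cast_nonneg _)
    · exact Finset.sum_nonneg fun A _ => div_nonneg (hy.1.1 _) (Nat.cast_nonneg _)
  · rintro (a | b) h
    · obtain ⟨A, haA, hne⟩ := Finset.exists_ne_zero_of_sum_ne_zero h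
      exact Finset.mem_toLeft.1
        (hA A (fun h0 => hne (by simp [h0])) (Finset.mem_filter.1 haA).2)
    · obtain ⟨B, hbB, hne⟩ := Finset.exists_ne_zero_of_sum_ne_zero h
      exact Finset.mem_toRight.1
        (hB B (fun h0 => hne (by simp [h0])) (Finset.mem_filter.1 hbB).2)

theorem eq_of_div_card_eq {γ : Type*} {y w : Finset γ → ℝ} (hy : y ∅ = 0) (hw : w ∅ = 0)
    (h : (fun A : Finset γ => y A / (A.card : ℝ)) = fun A => w A / (A.card : ℝ)) : y = w := by
  funext A
  rcases A.eq_empty_or_nonempty with rfl | hA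
  · rw [hy, hw]
  · have : (A.card : ℝ) ≠ 0 := by exact_mod_cast hA.card_pos.ne'
    exact (div_left_inj' this).1 (congrFun h A)

theorem subdivisionMap_injOn (K : PreAbstractSimplicialComplex (α ⊕ β)) :
    Set.InjOn subdivisionMap (geomRealization (shoreSubdivision K)) := by
  intro y hy w hw h
  obtain ⟨yl, yr, yl0, yr0, -⟩ := shoreSubdivision_support hy
  obtain ⟨wl, wr, wl0, wr0, -⟩ := shoreSubdivision_support hw
  have hnz : ∀ {r : ℝ} {n : ℕ}, r / (n : ℝ) ≠ 0 → r ≠ 0 := fun h h0 => h (by simp [h0])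
  have hL := chain_weights_unique (z := fun A => y (Sum.inl A) / (A.card : ℝ))
    (w := fun A => w (Sum.inl A) / (A.card : ℝ))
    (fun A => div_nonneg (hy.1.1 _) (Nat.cast_nonneg _))
    (fun A => div_nonneg (hw.1.1 _) (Nat.cast_nonneg _))
    (fun A B hA hB => yl A B (hnz hA) (hnz hB)) (fun A B hA hB => wl A B (hnz hA) (hnz hB))
    (by simp) (by simp) (fun a => congrFun h (Sum.inl a))
  have hR := chain_weights_unique (z := fun A => y (Sum.inr A) / (A.card : ℝ))
    (w := fun A => w (Sum.inr A) / (A.card : ℝ))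
    (fun A => div_nonneg (hy.1.1 _) (Nat.cast_nonneg _))
    (fun A => div_nonneg (hw.1.1 _) (Nat.cast_nonneg _))
    (fun A B hA hB => yr A B (hnz hA) (hnz hB)) (fun A B hA hB => wr A B (hnz hA) (hnz hB))
    (by simp) (by simp) (fun b => congrFun h (Sum.inr b))
  funext C
  rcases C with A | B
  · exact congrFun (eq_of_div_card_eq (y := fun A => y (Sum.inl A))
      (w := fun A => w (Sum.inl A)) yl0 wl0 hL) A
  · exact congrFun (eq_of_div_card_eq (y := fun A => y (Sum.inr A))
      (w := fun A => w (Sum.inr A)) yr0 wr0 hR) B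

theorem card_mul_div_card {γ : Type*} {s : Finset γ} {c : γ} (r : ℝ) (hc : c ∈ s) :
    (s.card : ℝ) * r / (s.card : ℝ) = r :=
  mul_div_cancel_left₀ r (Nat.cast_ne_zero.2 (Finset.card_ne_zero_of_mem hc))

theorem subdivisionMap_surjOn (K : PreAbstractSimplicialComplex (α ⊕ β)) :
    Set.SurjOn subdivisionMap (geomRealization (shoreSubdivision K)) (geomRealization K) := by
  intro x hx
  obtain ⟨z, z0, zc, zs, zx⟩ := exists_chain_weights (fun a => x (Sum.inl a)) fun a => hx.1.1 _
  obtain ⟨w, w0, wc, ws, wx⟩ := exists_chain_weights (fun b => x (Sum.inr b)) fun b => hx.1.1 _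
  set y : Finset α ⊕ Finset β → ℝ :=
    Sum.elim (fun A => A.card * z A) (fun B => B.card * w B) with hy
  have hyx : subdivisionMap y = x := by
    funext c
    rcases c with a | b
    · refine (Finset.sum_congr rfl fun A hA => ?_).trans (zx a)
      exact card_mul_div_card _ (Finset.mem_filter.1 hA).2
    · refine (Finset.sum_congr rfl fun B hB => ?_).trans (wx b)
      exact card_mul_div_card _ (Finset.mem_filter.1 hB).2
  have hy1 : ∑ C, y C = 1 := by
    rw [← sum_subdivisionMap (y := y) (by simp [hy]) (by simp [hy]), hyx, hx.1.2]
  refine ⟨y, ⟨⟨?_, hy1⟩, ?_, ?_, ?_, _, hx.2, ?_, ?_⟩, hyx⟩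
  · rintro (A | B)
    · exact mul_nonneg (Nat.cast_nonneg _) (z0 A)
    · exact mul_nonneg (Nat.cast_nonneg _) (w0 B)
  · obtain ⟨C, -, hC⟩ := Finset.exists_ne_zero_of_sum_ne_zero (hy1.trans_ne one_ne_zero)
    exact ⟨C, by simpa using hC⟩
  · intro A hA B hB _
    simp only [Finset.mem_coe, Finset.mem_toLeft, Finset.mem_filter, hy, Sum.elim_inl] at hA hB
    exact zc A B (right_ne_zero_of_mul hA.2) (right_ne_zero_of_mul hB.2)
  · intro A hA B hB _
    simp only [Finset.mem_coe, Finset.mem_toRight, Finset.mem_filter, hy, Sum.elim_inr] at hA hB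
    exact wc A B (right_ne_zero_of_mul hA.2) (right_ne_zero_of_mul hB.2)
  · intro A hA
    simp only [Finset.mem_toLeft, Finset.mem_filter, hy, Sum.elim_inl] at hA
    obtain ⟨h1, h2⟩ := zs A (right_ne_zero_of_mul hA.2)
    exact ⟨h1, fun a ha => by simpa using h2 a ha⟩
  · intro B hB
    simp only [Finset.mem_toRight, Finset.mem_filter, hy, Sum.elim_inr] at hB
    obtain ⟨h1, h2⟩ := ws B (right_ne_zero_of_mul hB.2)
    exact ⟨h1, fun b hb => by simpa using h2 b hb⟩

/-- The canonical map `‖ssd K‖ → ‖K‖` is a continuous bijection of compact Hausdorff spaces. -/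
theorem exists_homeomorph_subdivisionMap (K : PreAbstractSimplicialComplex (α ⊕ β)) :
    ∃ e : geomRealization (shoreSubdivision K) ≃ₜ geomRealization K,
      ∀ y, (e y : α ⊕ β → ℝ) = subdivisionMap (y : Finset α ⊕ Finset β → ℝ) := by
  have hbij : Set.BijOn subdivisionMap (geomRealization (shoreSubdivision K))
      (geomRealization K) :=
    ⟨subdivisionMap_mapsTo K, subdivisionMap_injOn K, subdivisionMap_surjOn K⟩
  have : CompactSpace (geomRealization (shoreSubdivision K)) :=
    isCompact_iff_compactSpace.1 (isCompact_geomRealization _)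
  have hcont : Continuous (hbij.equiv subdivisionMap) :=
    (continuous_subdivisionMap.comp continuous_subtype_val).subtype_mk _
  exact ⟨hcont.homeoOfEquivCompactToT2, fun y => rfl⟩

end Subdivision

/-! ### Closed sets and faces of the shore subdivision of the box complex -/

section Graph

variable {V : Type*} [Fintype V] (G : SimpleGraph V)

theorem mem_commonNbhd {A : Finset V} {v : V} : v ∈ commonNbhd G A ↔ ∀ a ∈ A, G.Adj a v := by
  simp [commonNbhd]

/-- Common neighborhoods form a Galois connection of the subsets of `V` with themselves. -/
theorem subset_commonNbhd_comm {A B : Finset V} : A ⊆ commonNbhd G B ↔ B ⊆ commonNbhd G A := by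
  simp only [Finset.subset_iff, mem_commonNbhd]
  exact ⟨fun h b hb a ha => (h ha b hb).symm, fun h a ha b hb => (h hb a ha).symm⟩

theorem subset_commonNbhd_commonNbhd (A : Finset V) : A ⊆ commonNbhd G (commonNbhd G A) :=
  (subset_commonNbhd_comm G).1 subset_rfl

theorem commonNbhd_triple (A : Finset V) :
    commonNbhd G (commonNbhd G (commonNbhd G A)) = commonNbhd G A :=
  (commonNbhd_anti G (subset_commonNbhd_commonNbhd G A)).antisymm
    (subset_commonNbhd_commonNbhd G _)

theorem not_subset_commonNbhd {A : Finset V} (hA : A.Nonempty) : ¬A ⊆ commonNbhd G A := by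
  obtain ⟨a, ha⟩ := hA
  exact fun h => (mem_commonNbhd G).1 (h ha) a ha |>.ne rfl

theorem commonNbhd_ne_self {A : Finset V} (hA : A.Nonempty) : commonNbhd G A ≠ A :=
  fun h => not_subset_commonNbhd G hA h.ge

/-- Two vertices of the shore subdivision of the box complex span an edge if they are nested sets
on the same shore, or sets on different shores that are completely joined in `G`. -/
def shoreCompatible : Finset V ⊕ Finset V → Finset V ⊕ Finset V → Prop
  | Sum.inl A, Sum.inl B => A ⊆ B ∨ B ⊆ A
  | Sum.inr A, Sum.inr B => A ⊆ B ∨ B ⊆ A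
  | Sum.inl A, Sum.inr B => B ⊆ commonNbhd G A
  | Sum.inr A, Sum.inl B => B ⊆ commonNbhd G A

/-- The node set of a vertex of the shore subdivision. -/
def nodeSet {V : Type*} : Finset V ⊕ Finset V → Finset V := Sum.elim id id

theorem shoreCompatible.symm {u v : Finset V ⊕ Finset V} (h : shoreCompatible G u v) :
    shoreCompatible G v u := by
  rcases u with A | A <;> rcases v with B | B
  exacts [Or.symm h, (subset_commonNbhd_comm G).1 h, (subset_commonNbhd_comm G).1 h, Or.symm h]

theorem shoreCompatible.swap {u v : Finset V ⊕ Finset V} (h : shoreCompatible G u v) :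
    shoreCompatible G u.swap v.swap := by
  rcases u with A | A <;> rcases v with B | B <;> exact h

theorem exists_mem_forall_subset_of_isChain {α : Type*} {S : Finset (Finset α)}
    (hS : S.Nonempty) (hc : IsChain (· ⊆ ·) (S : Set (Finset α))) : ∃ A ∈ S, ∀ B ∈ S, B ⊆ A := by
  obtain ⟨A, hA, hmax⟩ := S.exists_max_image Finset.card hS
  refine ⟨A, hA, fun B hB => ?_⟩
  rcases hc.total (Finset.mem_coe.2 hB) (Finset.mem_coe.2 hA) with h | h
  exacts [h, (Finset.eq_of_subset_of_card_le h (hmax B hB)).ge]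

/-- The union of a chain of sets with common neighbors has a common neighbor. -/
theorem commonNbhd_sup_nonempty [Nonempty V] [DecidableEq V] {S : Finset (Finset V)}
    (hc : IsChain (· ⊆ ·) (S : Set (Finset V))) (h : ∀ A ∈ S, (commonNbhd G A).Nonempty) :
    (commonNbhd G (S.sup id)).Nonempty := by
  rcases S.eq_empty_or_nonempty with rfl | hS
  · exact ⟨Classical.arbitrary V, by simp [mem_commonNbhd]⟩
  · obtain ⟨A, hA, hmax⟩ := exists_mem_forall_subset_of_isChain hS hc
    exact (h A hA).mono (commonNbhd_anti G (Finset.sup_le hmax))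

/-- The shore subdivision of the box complex is a flag complex. -/
theorem mem_shoreSubdivision_boxComplex {τ : Finset (Finset V ⊕ Finset V)} :
    τ ∈ (shoreSubdivision (boxComplex G)).faces ↔ τ.Nonempty ∧
      (∀ u ∈ τ, (nodeSet u).Nonempty ∧ (commonNbhd G (nodeSet u)).Nonempty) ∧
      ∀ u ∈ τ, ∀ v ∈ τ, shoreCompatible G u v := by
  classical
  constructor
  · rintro ⟨hne, hl, hr, σ, hσ, hA, hB⟩
    have hlr : ∀ A B, Sum.inl A ∈ τ → Sum.inr B ∈ τ → B ⊆ commonNbhd G A := by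
      intro A B h1 h2 b hb
      exact (mem_commonNbhd G).2 fun a ha => hσ.2.2.2 a ((hA A (by simpa using h1)).2 ha) b
        ((hB B (by simpa using h2)).2 hb)
    refine ⟨hne, ?_, ?_⟩
    · rintro (A | B) h
      · obtain ⟨h1, h2⟩ := hA A (by simpa using h)
        exact ⟨h1, hσ.2.1.mono (commonNbhd_anti G h2)⟩
      · obtain ⟨h1, h2⟩ := hB B (by simpa using h)
        exact ⟨h1, hσ.2.2.1.mono (commonNbhd_anti G h2)⟩
    · rintro (A | A) hA (B | B) hB
      · exact hl.total (by simpa using hA) (by simpa using hB)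
      · exact hlr A B hA hB
      · exact (subset_commonNbhd_comm G).1 (hlr B A hB hA)
      · exact hr.total (by simpa using hA) (by simpa using hB)
  · rintro ⟨hne, hgood, hcomp⟩
    have hl : IsChain (· ⊆ ·) (τ.toLeft : Set (Finset V)) := fun A hA B hB _ =>
      hcomp (Sum.inl A) (by simpa using hA) (Sum.inl B) (by simpa using hB)
    have hr : IsChain (· ⊆ ·) (τ.toRight : Set (Finset V)) := fun A hA B hB _ =>
      hcomp (Sum.inr A) (by simpa using hA) (Sum.inr B) (by simpa using hB)
    obtain ⟨u, hu⟩ := hne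
    obtain ⟨v, hv⟩ := (hgood u hu).1
    have : Nonempty V := ⟨v⟩
    refine ⟨⟨u, hu⟩, hl, hr, (τ.toLeft.sup id).disjSum (τ.toRight.sup id), ⟨?_, ?_, ?_, ?_⟩,
      fun A hA => ⟨(hgood (Sum.inl A) (by simpa using hA)).1, ?_⟩,
      fun B hB => ⟨(hgood (Sum.inr B) (by simpa using hB)).1, ?_⟩⟩
    · rcases u with A | B
      · exact ⟨Sum.inl v, Finset.inl_mem_disjSum.2
          (Finset.mem_sup.2 ⟨A, Finset.mem_toLeft.2 hu, hv⟩)⟩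
      · exact ⟨Sum.inr v, Finset.inr_mem_disjSum.2
          (Finset.mem_sup.2 ⟨B, Finset.mem_toRight.2 hu, hv⟩)⟩
    · rw [Finset.toLeft_disjSum]
      exact commonNbhd_sup_nonempty G hl fun A hA => (hgood (Sum.inl A) (by simpa using hA)).2
    · rw [Finset.toRight_disjSum]
      exact commonNbhd_sup_nonempty G hr fun B hB => (hgood (Sum.inr B) (by simpa using hB)).2
    · rw [Finset.toLeft_disjSum, Finset.toRight_disjSum]
      intro a ha b hb
      obtain ⟨A, hA, haA⟩ := Finset.mem_sup.1 ha
      obtain ⟨B, hB, hbB⟩ := Finset.mem_sup.1 hb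
      exact (mem_commonNbhd G).1 (hcomp (Sum.inl A) (by simpa using hA) (Sum.inr B)
        (by simpa using hB) hbB) a haA
    · rw [Finset.toLeft_disjSum]
      exact Finset.le_sup (f := id) hA
    · rw [Finset.toRight_disjSum]
      exact Finset.le_sup (f := id) hB

theorem shoreClosure_idem (u : Finset V ⊕ Finset V) :
    shoreClosure G (shoreClosure G u) = shoreClosure G u := by
  rcases u with A | A <;> simp [shoreClosure, commonNbhd_triple]

theorem nodeSet_shoreClosure (u : Finset V ⊕ Finset V) :
    nodeSet (shoreClosure G u) = commonNbhd G (commonNbhd G (nodeSet u)) := by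
  rcases u with A | A <;> rfl

theorem shoreCompatible.closure {u v : Finset V ⊕ Finset V} (h : shoreCompatible G u v) :
    shoreCompatible G (shoreClosure G u) (shoreClosure G v) := by
  rcases u with A | A <;> rcases v with B | B
  · exact Or.imp (fun h => commonNbhd_anti G (commonNbhd_anti G h))
      (fun h => commonNbhd_anti G (commonNbhd_anti G h)) h
  · exact commonNbhd_anti G (commonNbhd_anti G h)
  · exact commonNbhd_anti G (commonNbhd_anti G h)
  · exact Or.imp (fun h => commonNbhd_anti G (commonNbhd_anti G h))
      (fun h => commonNbhd_anti G (commonNbhd_anti G h)) h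

theorem subset_of_comparable {α : Type*} {A B : Finset α} (h : B ⊆ A ∨ A ⊆ B) (hlt : ¬A < B) :
    B ⊆ A := by
  rcases h with h | h
  · exact h
  · exact (eq_of_le_of_not_lt h hlt).ge

/-- On a common shore `v` must not be the smaller set: `A ⊂ B` does not make `CN²(A)` and `B`
comparable. -/
theorem shoreCompatible.closure_right {u v : Finset V ⊕ Finset V} (h : shoreCompatible G u v)
    (hlt : ¬v < u) : shoreCompatible G u (shoreClosure G v) := by
  rcases u with A | A <;> rcases v with B | B
  · exact Or.inl ((subset_of_comparable h (fun h' => hlt (Sum.inl_lt_inl_iff.2 h'))).trans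
      (subset_commonNbhd_commonNbhd G B))
  · exact (commonNbhd_anti G (commonNbhd_anti G h)).trans (commonNbhd_triple G A).le
  · exact (commonNbhd_anti G (commonNbhd_anti G h)).trans (commonNbhd_triple G A).le
  · exact Or.inl ((subset_of_comparable h (fun h' => hlt (Sum.inr_lt_inr_iff.2 h'))).trans
      (subset_commonNbhd_commonNbhd G B))

/-! ### The jump map -/

theorem IsCardRefinement.asymm {W : Type*} {prec : Finset W → Finset W → Prop}
    (hprec : IsCardRefinement prec) {A B : Finset W} (h : prec A B) :
    ¬prec B A :=
  fun h' => hprec.1.irrefl _ (hprec.1.trans _ _ _ h h')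

theorem IsCardRefinement.card_le {W : Type*} {prec : Finset W → Finset W → Prop}
    (hprec : IsCardRefinement prec) {A B : Finset W}
    (h : prec A B) : A.card ≤ B.card :=
  not_lt.1 fun h' => hprec.asymm h (hprec.2 B A h')

theorem IsCardRefinement.prec_or {W : Type*} {prec : Finset W → Finset W → Prop}
    (hprec : IsCardRefinement prec) {A B : Finset W}
    (h : A ≠ B) : prec A B ∨ prec B A := by
  by_contra hn
  rw [not_or] at hn
  exact h (hprec.1.trichotomous _ _ hn.1 hn.2)

variable {prec : Finset V → Finset V → Prop}

/-- The sets `A` with `CN(A) ≺ A`, which are those that jump, are upward closed. -/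
theorem IsCardRefinement.prec_of_subset (hprec : IsCardRefinement prec) {A B : Finset V}
    (h : prec (commonNbhd G A) A) (hAB : A ⊆ B) : prec (commonNbhd G B) B := by
  rcases eq_or_ssubset_of_subset hAB with rfl | hAB'
  · exact h
  · exact hprec.2 _ _ ((Finset.card_le_card (commonNbhd_anti G hAB)).trans_lt
      ((hprec.card_le h).trans_lt (Finset.card_lt_card hAB')))

/-- Sets on opposite shores of a simplex do not both jump: by the cardinalities each would be the
common neighborhood of the other, and only the larger of the two jumps. -/
theorem IsCardRefinement.not_prec_of_joined (hprec : IsCardRefinement prec) {A B : Finset V}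
    (hAB : B ⊆ commonNbhd G A) (hA : prec (commonNbhd G A) A) : ¬prec (commonNbhd G B) B := by
  intro hB
  have hBA := (subset_commonNbhd_comm G).1 hAB
  have h1 := hprec.card_le hA
  have h2 := hprec.card_le hB
  have h3 := Finset.card_le_card hAB
  have h4 := Finset.card_le_card hBA
  rw [← Finset.eq_of_subset_of_card_le hAB (by omega)] at hA
  rw [← Finset.eq_of_subset_of_card_le hBA (by omega)] at hB
  exact hprec.asymm hA hB

variable (prec) in
theorem jumpMap_swap (u : Finset V ⊕ Finset V) :
    jumpMap G prec u.swap = (jumpMap G prec u).swap := by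
  rcases u with A | A <;> simp only [jumpMap, Sum.swap, Sum.elim_inl, Sum.elim_inr] <;>
    split_ifs <;> rfl

variable (prec) in
theorem nodeSet_jumpMap (u : Finset V ⊕ Finset V) :
    nodeSet (jumpMap G prec u) = nodeSet u ∨
      nodeSet (jumpMap G prec u) = commonNbhd G (nodeSet u) := by
  rcases u with A | A <;> simp only [jumpMap, Sum.elim_inl, Sum.elim_inr] <;> split_ifs <;>
    simp [nodeSet]

theorem jumpMap_idem (hprec : IsCardRefinement prec) {u : Finset V ⊕ Finset V}
    (hu : commonNbhd G (commonNbhd G (nodeSet u)) = nodeSet u) :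
    jumpMap G prec (jumpMap G prec u) = jumpMap G prec u := by
  have key : ∀ A, commonNbhd G (commonNbhd G A) = A → prec (commonNbhd G A) A →
      ¬prec (commonNbhd G (commonNbhd G A)) (commonNbhd G A) := fun A hA h => by
    rw [hA]
    exact hprec.asymm h
  rcases u with A | A <;> by_cases h : prec (commonNbhd G A) A
  · simp [jumpMap, h, key A hu h]
  · simp [jumpMap, h]
  · simp [jumpMap, h, key A hu h]
  · simp [jumpMap, h]

theorem shoreCompatible.jump_right {u v : Finset V ⊕ Finset V} (h : shoreCompatible G u v)
    (hlt : ¬v < u) : shoreCompatible G u (jumpMap G prec v) := by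
  rcases u with A | A <;> rcases v with B | B <;>
    simp only [jumpMap, Sum.elim_inl, Sum.elim_inr] <;> split_ifs
  · exact commonNbhd_anti G (subset_of_comparable h fun h' => hlt (Sum.inl_lt_inl_iff.2 h'))
  · exact h
  · exact Or.inl ((subset_commonNbhd_comm G).1 h)
  · exact h
  · exact Or.inl ((subset_commonNbhd_comm G).1 h)
  · exact h
  · exact commonNbhd_anti G (subset_of_comparable h fun h' => hlt (Sum.inr_lt_inr_iff.2 h'))
  · exact h

theorem shoreCompatible.jump (hprec : IsCardRefinement prec) {u v : Finset V ⊕ Finset V}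
    (h : shoreCompatible G u v) :
    shoreCompatible G (jumpMap G prec u) (jumpMap G prec v) := by
  have same : ∀ A B : Finset V, prec (commonNbhd G A) A → ¬prec (commonNbhd G B) B →
      (A ⊆ B ∨ B ⊆ A) → commonNbhd G A ⊆ commonNbhd G B := fun A B hA hB h =>
    commonNbhd_anti G (h.resolve_left fun h => hB (hprec.prec_of_subset G hA h))
  rcases u with A | A <;> rcases v with B | B <;>
    simp only [jumpMap, Sum.elim_inl, Sum.elim_inr] <;> split_ifs with hA hB hB
  · exact Or.symm (Or.imp (commonNbhd_anti G) (commonNbhd_anti G) h)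
  · exact (subset_commonNbhd_comm G).1 (same A B hA hB h)
  · exact same B A hB hA (Or.symm h)
  · exact h
  · exact absurd hB (hprec.not_prec_of_joined G h hA)
  · exact Or.inr h
  · exact Or.inl ((subset_commonNbhd_comm G).1 h)
  · exact h
  · exact absurd hB (hprec.not_prec_of_joined G h hA)
  · exact Or.inr h
  · exact Or.inl ((subset_commonNbhd_comm G).1 h)
  · exact h
  · exact Or.symm (Or.imp (commonNbhd_anti G) (commonNbhd_anti G) h)
  · exact (subset_commonNbhd_comm G).1 (same A B hA hB h)
  · exact same B A hB hA (Or.symm h)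
  · exact h

/-- The two copies `∅ ⊎ B` and `CN(B) ⊎ ∅` of a vertex jump to the same place. -/
theorem jumpMap_inl_commonNbhd (hprec : IsCardRefinement prec) {B : Finset V}
    (hB : B.Nonempty) (hcl : commonNbhd G (commonNbhd G B) = B) :
    jumpMap G prec (Sum.inl (commonNbhd G B)) = jumpMap G prec (Sum.inr B) := by
  have hiff : prec B (commonNbhd G B) ↔ ¬prec (commonNbhd G B) B :=
    ⟨hprec.asymm, (hprec.prec_or (commonNbhd_ne_self G hB)).resolve_left⟩
  by_cases h : prec (commonNbhd G B) B <;> simp [jumpMap, hiff, h, hcl]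

/-! ### Free actions on the complexes -/

theorem shoreSubdivision_swap_notMem {τ : Finset (Finset V ⊕ Finset V)}
    (hτ : τ ∈ (shoreSubdivision (boxComplex G)).faces) {u : Finset V ⊕ Finset V} (hu : u ∈ τ) :
    u.swap ∉ τ := by
  intro hs
  obtain ⟨-, hg, hc⟩ := (mem_shoreSubdivision_boxComplex G).1 hτ
  have h1 := (hg u hu).1
  have h2 := hc u hu _ hs
  rcases u with A | A <;> exact not_subset_commonNbhd G h1 h2

variable [DecidableEq V]

theorem boxComplex_isSimplicialZ2Space : IsSimplicialZ2Space Sum.swap (boxComplex G) := by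
  refine isSimplicialZ2Space_of_disjoint ?_ (fun _ _ a _ => Sum.swap_swap a) ?_
  · intro σ hσ
    have hl : (σ.image Sum.swap).toLeft = σ.toRight := by
      ext a
      simp
    have hr : (σ.image Sum.swap).toRight = σ.toLeft := by
      ext a
      simp
    refine ⟨hσ.1.image _, ?_, ?_, ?_⟩
    · rw [hl]
      exact hσ.2.2.1
    · rw [hr]
      exact hσ.2.1
    · rw [hl, hr]
      exact fun a ha b hb => (hσ.2.2.2 b hb a ha).symm
  · rintro σ hσ (a | a) ha hs
    · exact (hσ.2.2.2 a (by simpa using ha) a (by simpa using hs)).ne rfl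
    · exact (hσ.2.2.2 a (by simpa using hs) a (by simpa using ha)).ne rfl

theorem shoreSubdivision_isSimplicialZ2Space :
    IsSimplicialZ2Space Sum.swap (shoreSubdivision (boxComplex G)) := by
  refine isSimplicialZ2Space_of_disjoint ?_ (fun _ _ a _ => Sum.swap_swap a)
    fun τ hτ u hu => shoreSubdivision_swap_notMem G hτ hu
  intro τ hτ
  rw [mem_shoreSubdivision_boxComplex] at hτ ⊢
  obtain ⟨hne, hg, hc⟩ := hτ
  refine ⟨hne.image _, ?_, ?_⟩
  · simp only [Finset.forall_mem_image]
    rintro (A | A) hA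
    exacts [hg (Sum.inl A) hA, hg (Sum.inr A) hA]
  · simp only [Finset.forall_mem_image]
    exact fun u hu v hv => (hc u hu v hv).swap

/-- The swap acts freely on every subcomplex of the shore subdivision that it preserves. -/
theorem isSimplicialZ2Space_of_subset {K : PreAbstractSimplicialComplex (Finset V ⊕ Finset V)}
    (hK : K.faces ⊆ (shoreSubdivision (boxComplex G)).faces)
    (hs : ∀ σ ∈ K.faces, σ.image Sum.swap ∈ K.faces) : IsSimplicialZ2Space Sum.swap K :=
  isSimplicialZ2Space_of_disjoint hs (fun _ _ a _ => Sum.swap_swap a)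
    fun _ hσ _ hu => shoreSubdivision_swap_notMem G (hK hσ) hu

theorem lovaszComplex_isSimplicialZ2Space :
    IsSimplicialZ2Space (commonNbhd G) (lovaszComplex G) := by
  refine isSimplicialZ2Space_of_disjoint ?_ (fun _ hσ A hA => hσ.2 A hA) ?_
  · rintro σ ⟨⟨hne, hK, hc⟩, hcl⟩
    refine ⟨⟨hne.image _, ?_, ?_⟩, ?_⟩
    · simp only [Finset.forall_mem_image]
      intro A hA
      refine ⟨(hK A hA).2, ?_⟩
      rw [show commonNbhd G (commonNbhd G A) = A from hcl A hA]
      exact (hK A hA).1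
    · rw [Finset.coe_image]
      rintro _ ⟨A, hA, rfl⟩ _ ⟨B, hB, rfl⟩ -
      exact (hc.total hA hB).symm.imp (commonNbhd_anti G) (commonNbhd_anti G)
    · simp only [Finset.forall_mem_image]
      exact fun A _ => commonNbhd_triple G A
  · rintro σ ⟨⟨-, hK, hc⟩, hcl⟩ A hA hN
    rcases hc.total (Finset.mem_coe.2 hA) (Finset.mem_coe.2 hN) with h | h
    · exact not_subset_commonNbhd G (hK A hA).1 h
    · refine not_subset_commonNbhd G (hK A hA).2 ?_
      rwa [show commonNbhd G (commonNbhd G A) = A from hcl A hA]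

/-- The flag condition reduces the sweep condition along a vertex map to pairs of vertices. -/
theorem union_image_mem_shoreSubdivision {f : Finset V ⊕ Finset V → Finset V ⊕ Finset V}
    {D U : Finset (Finset V ⊕ Finset V)} (h : D ∪ U ∈ (shoreSubdivision (boxComplex G)).faces)
    (hgood : ∀ a ∈ U, (nodeSet (f a)).Nonempty ∧ (commonNbhd G (nodeSet (f a))).Nonempty)
    (hDU : ∀ b ∈ D, ∀ a ∈ U, shoreCompatible G b a → shoreCompatible G b (f a))
    (hUU : ∀ a ∈ U, ∀ b ∈ U, shoreCompatible G a b → shoreCompatible G (f a) (f b)) :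
    D ∪ U.image f ∈ (shoreSubdivision (boxComplex G)).faces := by
  rw [mem_shoreSubdivision_boxComplex] at h ⊢
  obtain ⟨hne, hg, hc⟩ := h
  have hD : ∀ u ∈ D, u ∈ D ∪ U := fun u hu => Finset.mem_union_left _ hu
  have hU : ∀ u ∈ U, u ∈ D ∪ U := fun u hu => Finset.mem_union_right _ hu
  refine ⟨?_, ?_, ?_⟩
  · rcases Finset.union_nonempty.1 hne with h | h
    exacts [h.inl, (h.image f).inr]
  · intro u hu
    rcases Finset.mem_union.1 hu with hu | hu
    · exact hg u (hD u hu)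
    · obtain ⟨a, ha, rfl⟩ := Finset.mem_image.1 hu
      exact hgood a ha
  · have hDU' : ∀ u ∈ D, ∀ v ∈ U, shoreCompatible G u (f v) := fun u hu v hv =>
      hDU u hu v hv (hc u (hD u hu) v (hU v hv))
    intro u hu v hv
    rcases Finset.mem_union.1 hu with hu | hu <;> rcases Finset.mem_union.1 hv with hv | hv
    · exact hc u (hD u hu) v (hD v hv)
    · obtain ⟨b, hb, rfl⟩ := Finset.mem_image.1 hv
      exact hDU' u hu b hb
    · obtain ⟨a, ha, rfl⟩ := Finset.mem_image.1 hu
      exact (hDU' v hv a ha).symm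
    · obtain ⟨a, ha, rfl⟩ := Finset.mem_image.1 hu
      obtain ⟨b, hb, rfl⟩ := Finset.mem_image.1 hv
      exact hUU a ha b hb (hc a (hU a ha) b (hU b hb))

/-! ### Retraction onto the doubled Lovász complex -/

theorem union_image_shoreClosure_mem {D U : Finset (Finset V ⊕ Finset V)}
    (h : D ∪ U ∈ (shoreSubdivision (boxComplex G)).faces)
    (hlt : ∀ a ∈ U, ∀ b ∈ D, ¬a < b) :
    D ∪ U.image (shoreClosure G) ∈ (shoreSubdivision (boxComplex G)).faces := by
  refine union_image_mem_shoreSubdivision G h (fun a ha => ?_)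
    (fun b hb a ha hc => hc.closure_right G (hlt a ha b hb)) fun a _ b _ hc => hc.closure
  obtain ⟨h1, h2⟩ := ((mem_shoreSubdivision_boxComplex G).1 h).2.1 a (Finset.mem_union_right _ ha)
  rw [nodeSet_shoreClosure, commonNbhd_triple]
  exact ⟨h1.mono (subset_commonNbhd_commonNbhd G _), h2⟩

/-- The doubled Lovász complex is the subcomplex of the shore subdivision induced by the closed
sets. -/
theorem mem_doubledLovaszComplex {τ : Finset (Finset V ⊕ Finset V)} :
    τ ∈ (doubledLovaszComplex G).faces ↔ τ ∈ (shoreSubdivision (boxComplex G)).faces ∧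
      ∀ u ∈ τ, commonNbhd G (commonNbhd G (nodeSet u)) = nodeSet u := by
  constructor
  · rintro ⟨σ, hσ, rfl⟩
    refine ⟨?_, ?_⟩
    · simpa using union_image_shoreClosure_mem G (D := ∅) (U := σ) (by simpa using hσ) (by simp)
    · simp only [Finset.forall_mem_image]
      intro u _
      rw [nodeSet_shoreClosure, commonNbhd_triple]
  · rintro ⟨hτ, hcl⟩
    refine ⟨τ, hτ, (Finset.image_congr (g := id) fun u hu => ?_).trans Finset.image_id⟩
    have := hcl u hu
    rcases u with A | A
    · exact congrArg Sum.inl this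
    · exact congrArg Sum.inr this

theorem doubledLovaszComplex_retract :
    IsStrongZ2DeformationRetract (geomMap Sum.swap) (geomRealization (doubledLovaszComplex G))
      (geomRealization (shoreSubdivision (boxComplex G))) := by
  refine isStrongZ2DeformationRetract_map (shoreSubdivision_isSimplicialZ2Space G)
    Sum.swap_swap (fun _ _ h => Sum.swap_lt_swap_iff.2 h) ?_
    (fun _ _ u _ => shoreClosure_idem G u) fun D U => union_image_shoreClosure_mem G
  rintro (A | A) <;> rfl

theorem doubledLovaszComplex_isSimplicialZ2Space :
    IsSimplicialZ2Space Sum.swap (doubledLovaszComplex G) := by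
  refine isSimplicialZ2Space_of_subset G
    (fun τ hτ => ((mem_doubledLovaszComplex G).1 hτ).1) fun τ hτ => ?_
  rw [mem_doubledLovaszComplex] at hτ ⊢
  refine ⟨(shoreSubdivision_isSimplicialZ2Space G).1 τ hτ.1, ?_⟩
  simp only [Finset.forall_mem_image]
  rintro (A | A) hA
  exacts [hτ.2 (Sum.inl A) hA, hτ.2 (Sum.inr A) hA]

/-! ### Retraction onto the halved doubled Lovász complex -/

theorem union_image_jumpMap_mem (hprec : IsCardRefinement prec)
    {D U : Finset (Finset V ⊕ Finset V)} (h : D ∪ U ∈ (doubledLovaszComplex G).faces)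
    (hlt : ∀ a ∈ U, ∀ b ∈ D, ¬a < b) :
    D ∪ U.image (jumpMap G prec) ∈ (doubledLovaszComplex G).faces := by
  rw [mem_doubledLovaszComplex] at h ⊢
  obtain ⟨hss, hcl⟩ := h
  refine ⟨union_image_mem_shoreSubdivision G hss (fun a ha => ?_)
    (fun b hb a ha hc => hc.jump_right G (hlt a ha b hb)) fun a _ b _ hc => hc.jump G hprec, ?_⟩
  · have ha' := Finset.mem_union_right D ha
    obtain ⟨h1, h2⟩ := ((mem_shoreSubdivision_boxComplex G).1 hss).2.1 a ha'
    rcases nodeSet_jumpMap G prec a with h | h <;> rw [h]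
    · exact ⟨h1, h2⟩
    · rw [hcl a ha']
      exact ⟨h2, h1⟩
  · intro u hu
    rcases Finset.mem_union.1 hu with hu | hu
    · exact hcl u (Finset.mem_union_left _ hu)
    · obtain ⟨a, ha, rfl⟩ := Finset.mem_image.1 hu
      rcases nodeSet_jumpMap G prec a with h | h <;> rw [h]
      · exact hcl a (Finset.mem_union_right _ ha)
      · exact commonNbhd_triple G _

theorem halvedDoubledLovaszComplex_retract (hprec : IsCardRefinement prec) :
    IsStrongZ2DeformationRetract (geomMap Sum.swap)
      (geomRealization (halvedDoubledLovaszComplex G prec))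
      (geomRealization (doubledLovaszComplex G)) :=
  isStrongZ2DeformationRetract_map (doubledLovaszComplex_isSimplicialZ2Space G)
    Sum.swap_swap (fun _ _ h => Sum.swap_lt_swap_iff.2 h) (jumpMap_swap G prec)
    (fun _ hσ u hu => jumpMap_idem G hprec (((mem_doubledLovaszComplex G).1 hσ).2 u hu))
    fun _ _ => union_image_jumpMap_mem G hprec

/-! ### The isomorphism with the Lovász complex -/

theorem halvedDoubledLovaszComplex_isSimplicialZ2Space (hprec : IsCardRefinement prec) :
    IsSimplicialZ2Space Sum.swap (halvedDoubledLovaszComplex G prec) := by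
  refine isSimplicialZ2Space_of_subset G ?_ ?_
  · rintro _ ⟨σ, hσ, rfl⟩
    have := union_image_jumpMap_mem G hprec (D := ∅) (U := σ) (by simpa using hσ) (by simp)
    rw [Finset.empty_union] at this
    exact ((mem_doubledLovaszComplex G).1 this).1
  · rintro _ ⟨σ, hσ, rfl⟩
    refine ⟨σ.image Sum.swap, (doubledLovaszComplex_isSimplicialZ2Space G).1 σ hσ, ?_⟩
    simp only [Finset.image_image]
    exact Finset.image_congr fun u _ => jumpMap_swap G prec u

theorem image_inl_mem_doubledLovaszComplex {σ : Finset (Finset V)}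
    (hσ : σ ∈ (lovaszComplex G).faces) : σ.image Sum.inl ∈ (doubledLovaszComplex G).faces := by
  obtain ⟨⟨hne, hK, hc⟩, hcl⟩ := hσ
  rw [mem_doubledLovaszComplex, mem_shoreSubdivision_boxComplex]
  simp only [Finset.forall_mem_image]
  exact ⟨⟨hne.image _, hK, fun A hA B hB => hc.total hA hB⟩, hcl⟩

/-- Moving the right shore to the left by `CN` turns a simplex of the doubled Lovász complex into a
chain of closed sets. -/
theorem image_commonNbhd_mem_lovaszComplex {τ : Finset (Finset V ⊕ Finset V)}
    (hτ : τ ∈ (doubledLovaszComplex G).faces) :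
    τ.image (Sum.elim id (commonNbhd G)) ∈ (lovaszComplex G).faces := by
  rw [mem_doubledLovaszComplex, mem_shoreSubdivision_boxComplex] at hτ
  obtain ⟨⟨hne, hg, hc⟩, hcl⟩ := hτ
  refine ⟨⟨hne.image _, ?_, ?_⟩, ?_⟩
  · simp only [Finset.forall_mem_image]
    rintro (A | B) h
    · exact hg (Sum.inl A) h
    · refine ⟨(hg (Sum.inr B) h).2, ?_⟩
      change (commonNbhd G (commonNbhd G B)).Nonempty
      rw [show commonNbhd G (commonNbhd G B) = B from hcl (Sum.inr B) h]
      exact (hg (Sum.inr B) h).1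
  · rw [Finset.coe_image]
    rintro _ ⟨u, hu, rfl⟩ _ ⟨v, hv, rfl⟩ -
    have := hc u hu v hv
    rcases u with A | A <;> rcases v with B | B
    · exact this
    · exact Or.inl ((subset_commonNbhd_comm G).1 this)
    · exact Or.inr this
    · exact Or.symm (Or.imp (commonNbhd_anti G) (commonNbhd_anti G) this)
  · simp only [Finset.forall_mem_image]
    rintro (A | B) h
    · exact hcl (Sum.inl A) h
    · exact commonNbhd_triple G B

theorem lovaszComplex_isZ2Isomorphic (hprec : IsCardRefinement prec) :
    IsZ2Isomorphic (commonNbhd G) (lovaszComplex G) Sum.swap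
      (halvedDoubledLovaszComplex G prec) := by
  refine ⟨lovaszComplex_isSimplicialZ2Space G,
    halvedDoubledLovaszComplex_isSimplicialZ2Space G hprec,
    fun A => jumpMap G prec (Sum.inl A), ?_, ?_, ?_⟩
  · intro A hA B hB h
    have hA' : commonNbhd G (commonNbhd G A) = A := hA.2 A (Finset.mem_singleton_self A)
    have hB' : commonNbhd G (commonNbhd G B) = B := hB.2 B (Finset.mem_singleton_self B)
    simp only [jumpMap, Sum.elim_inl] at h
    split_ifs at h
    · rw [← hA', ← hB', Sum.inr.inj h]
    · exact Sum.inl.inj h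
  · refine PreAbstractSimplicialComplex.ext (Set.Subset.antisymm ?_ ?_)
    · rintro _ ⟨σ, hσ, rfl⟩
      refine ⟨σ.image Sum.inl, image_inl_mem_doubledLovaszComplex G hσ, ?_⟩
      simp only [Finset.image_image]
      rfl
    · rintro _ ⟨τ, hτ, rfl⟩
      refine ⟨_, image_commonNbhd_mem_lovaszComplex G hτ, ?_⟩
      simp only [Finset.image_image]
      rw [mem_doubledLovaszComplex, mem_shoreSubdivision_boxComplex] at hτ
      refine Finset.image_congr fun u hu => ?_
      rcases u with A | B
      · rfl
      · exact jumpMap_inl_commonNbhd G hprec (hτ.1.2.1 (Sum.inr B) hu).1 (hτ.2 (Sum.inr B) hu)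
  · intro A hA
    have hne : A.Nonempty := (hA.1.2.1 A (Finset.mem_singleton_self A)).1
    change jumpMap G prec (Sum.inl (commonNbhd G A)) = (jumpMap G prec (Sum.inl A)).swap
    rw [jumpMap_inl_commonNbhd G hprec hne (hA.2 A (Finset.mem_singleton_self A)),
      ← jumpMap_swap]
    rfl

end Graph

theorem theorem3 {V : Type*} [Fintype V] [DecidableEq V] (G : SimpleGraph V)
    (prec : Finset V → Finset V → Prop) (hprec : IsCardRefinement prec) :
    -- the halved doubled Lovász complex is `ℤ₂`-isomorphic to the Lovász complex
    IsZ2Isomorphic (commonNbhd G) (lovaszComplex G)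
      Sum.swap (halvedDoubledLovaszComplex G prec) ∧
    -- `‖ssd B(G)‖` is identified with `‖B(G)‖` by the canonical equivariant homeomorphism, and the
    -- image of the halved doubled Lovász complex is a strong `ℤ₂`-deformation retract of `‖B(G)‖`
    (∃ e : geomRealization (shoreSubdivision (boxComplex G)) ≃ₜ geomRealization (boxComplex G),
      (∀ y, (e y : V ⊕ V → ℝ) = subdivisionMap (y : Finset V ⊕ Finset V → ℝ)) ∧
      (∀ y ∈ geomRealization (shoreSubdivision (boxComplex G)),
        subdivisionMap (geomMap Sum.swap y) = geomMap Sum.swap (subdivisionMap y)) ∧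
      IsStrongZ2DeformationRetract (geomMap Sum.swap)
        (subdivisionMap '' geomRealization (halvedDoubledLovaszComplex G prec))
        (geomRealization (boxComplex G))) ∧
    -- the two intermediate deformation retractions
    IsStrongZ2DeformationRetract (geomMap Sum.swap)
      (geomRealization (doubledLovaszComplex G))
      (geomRealization (shoreSubdivision (boxComplex G))) ∧
    IsStrongZ2DeformationRetract (geomMap Sum.swap)
      (geomRealization (halvedDoubledLovaszComplex G prec))
      (geomRealization (doubledLovaszComplex G)) := by
  have hretract := (halvedDoubledLovaszComplex_retract G hprec).trans
    (doubledLovaszComplex_retract G)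
  obtain ⟨e, he⟩ := exists_homeomorph_subdivisionMap (boxComplex G)
  exact ⟨lovaszComplex_isZ2Isomorphic G hprec,
    ⟨e, he, fun y _ => subdivisionMap_geomMap_swap y,
      hretract.image_homeomorph (boxComplex_isSimplicialZ2Space G).2 e he
        fun y _ => subdivisionMap_geomMap_swap y⟩,
    doubledLovaszComplex_retract G, halvedDoubledLovaszComplex_retract G hprec⟩
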